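/- **Setting.** Let $d\ge 1$ be an integer, $T\ge 0$, let $S_d=\{m\in\mathbb R^d: m_i\ge 0,\ \sum_i m_i=1\}$ carry the Euclidean norm, and, for an integer $N\ge1$, let $S_d^N=S_d\cap\frac1N\mathbb N^d$. Let $(A,\mathbf d)$ be a (nonempty) compact metric space. For $i,j\in\{1,\dots,d\}$ let $Q_{i,j}:[0,T]\times A\times S_d\to[0,\infty)$ be the transition rates, $f^i:[0,T]\times A\times S_d\to\mathbb R$ the running costs and $g^i:S_d\to\mathbb R$ the terminal costs, and put $$F(t,a,m)=\sum_{i=1}^d m_i f^i(t,a^i,m),\qquad G(m)=\sum_{i=1}^d m_i g^i(m)\qquad (t\in[0,T],\ a=(a^1,\dots,a^d)\in A^d,\ m\in S_d).$$ **Assumption A.** Each $Q_{i,j}$ is continuous on $[0,T]\times A\times S_d$, $F$ is continuous on $[0,T]\times A^d\times S_d$, and there is a constant $L$ such that for all $s,t\in[0,T]$, all $m,p\in S_d$, all $i,j$, and all actions $b\in A$, $a\in A^d$, $$|Q_{i,j}(t,b,m)-Q_{i,j}(s,b,p)|\le L(|t-s|+|m-p|),\quad |F(t,a,m)-F(s,a,p)|\le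 L(|t-s|+|m-p|),\quad |G(m)-G(p)|\le L|m-p|.$$ No convexity is assumed. **$N$-agent problem.** A feedback control is a measurable function $\alpha_N:[0,T]\times S_d^N\to A^d$. Under $\alpha_N$ the empirical measure $\mu^N$ of the $N$ agents is the time-inhomogeneous Markov chain on $S_d^N$ which, at time $t$, jumps from $m$ to $m+\frac1N(\delta_j-\delta_i)$, $i\ne j$, at rate $N\,m_i\,Q_{i,j}(t,\alpha_N^i(t,m),m)$, where $\delta_1,\dots,\delta_d$ is the standard basis of $\mathbb R^d$. For $t\in[0,T]$ and $m\in S_d^N$ set $$V^N(t,m)=\inf_{\alpha_N}\ \mathbb E\Big[\int_t^T F\big(s,\alpha_N(s,\mu^N_s),\mu^N_s\big)\,ds+G(\mu^N_T)\ \Big|\ \mu^N_t=m\Big].$$ **Mean field control problem.** For $t\in[0,T]$ and $m\in S_d$ set $$V(t,m)=\inf_{\alpha}\ \Big\{\int_t^T F(s,\alpha(s),\mu_s)\,ds+G(\mu_T)\Big\},$$ the infimum being over measurable $\alpha:[0,T]\to A^d$, where $\mu:[t,T]\to S_d$ is the (Carathéodory) solution of $$\frac{d}{ds}\mu^i_s=\sum_{j=1}^d\Big(\mu^j_s\,Q_{j,i}(s,\alpha^j(s),\mu_s)-\mu^i_s\,Q_{i,j}(s,\alpha^i(s),\mu_s)\Big),\qquad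 \mu_t=m .$$ **Theorem.** Under Assumption A there is a constant $C$, independent of $N$, such that for every integer $N\ge1$ the maximum below is attained and $$\max_{t\in[0,T],\ m\in S_d^N}\big|V^N(t,m)-V(t,m)\big|\le\frac{C}{\sqrt N}.$$ -/

import Mathlib

open Set

namespace MFC

/-- The simplex `S_d`, as a subset of Euclidean space `ℝ^d`. -/
def simplex (d : ℕ) : Set (EuclideanSpace ℝ (Fin d)) :=
  {m | (∀ i, 0 ≤ m i) ∧ ∑ i, m i = 1}

/-- The discretized simplex `S_d^N = S_d ∩ (1/N) ℕ^d`. -/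
def gridSimplex (d N : ℕ) : Set (EuclideanSpace ℝ (Fin d)) :=
  {m | m ∈ simplex d ∧ ∃ k : Fin d → ℕ, ∀ i, m i = (k i : ℝ) / N}

/-- `S_d^N` as a type: the state space of the empirical measure of `N` agents. -/
abbrev Grid (d N : ℕ) : Type := ↥(gridSimplex d N)

theorem gridSimplex_finite (d N : ℕ) : (gridSimplex d N).Finite := by
  refine Set.Finite.subset (Set.finite_range
    (fun k : Fin d → Fin (N + 1) => WithLp.toLp 2 (fun i => ((k i : ℕ) : ℝ) / N))) ?_
  rintro m ⟨⟨h0, h1⟩, k, hk⟩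
  have hle : ∀ i, m i ≤ 1 := fun i => by
    rw [← h1]
    exact Finset.single_le_sum (fun j _ => h0 j) (Finset.mem_univ i)
  rcases Nat.eq_zero_or_pos N with hz | hpos
  · refine ⟨fun _ => 0, ?_⟩
    ext i
    simp [hk i, hz]
  · have hN : (0 : ℝ) < N := Nat.cast_pos.mpr hpos
    have hb : ∀ i, k i < N + 1 := fun i => by
      have h := hle i
      rw [hk i, div_le_one hN] at h
      exact Nat.lt_succ_of_le (Nat.cast_le.mp h)
    refine ⟨fun i => ⟨k i, hb i⟩, ?_⟩
    ext i
    simp [hk i]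

noncomputable instance instFintypeGrid (d N : ℕ) : Fintype (Grid d N) :=
  (gridSimplex_finite d N).fintype

noncomputable instance instDecidableEqGrid (d N : ℕ) : DecidableEq (Grid d N) :=
  Classical.decEq _

/-- The data of the control problem with states `Fin d` and actions `A`: the horizon `T`, the
transition rates `Q i j t a m`, the running costs `f i t a m` and the terminal costs `g i m`.
Only their values for `t ∈ [0, T]` and `m ∈ S_d` are ever used. -/
structure Model (d : ℕ) (A : Type*) where
  T : ℝ
  Q : Fin d → Fin d → ℝ → A → EuclideanSpace ℝ (Fin d) → ℝ
  f : Fin d → ℝ → A → EuclideanSpace ℝ (Fin d) → ℝ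
  g : Fin d → EuclideanSpace ℝ (Fin d) → ℝ

namespace Model

variable {d : ℕ} {A : Type*}

/-- `F(t, a, m) = ∑ i, m_i f^i(t, a^i, m)` for `a ∈ A^d`. -/
def F (M : Model d A) (t : ℝ) (a : Fin d → A) (m : EuclideanSpace ℝ (Fin d)) : ℝ :=
  ∑ i, m i * M.f i t (a i) m

/-- `G(m) = ∑ i, m_i g^i(m)`. -/
def G (M : Model d A) (m : EuclideanSpace ℝ (Fin d)) : ℝ :=
  ∑ i, m i * M.g i m

/-- The conditions on rates and costs: the rates are nonnegative; the rates and the aggregate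
running cost are jointly continuous, and Lipschitz in `(t, m)` uniformly in the action; the
aggregate terminal cost is Lipschitz. (Compactness of the action space is a type class.) -/
structure Regular [TopologicalSpace A] (M : Model d A) : Prop where
  Q_nonneg : ∀ i j, ∀ t ∈ Icc 0 M.T, ∀ a, ∀ m ∈ simplex d, 0 ≤ M.Q i j t a m
  Q_continuous : ∀ i j, ContinuousOn
    (fun z : ℝ × A × EuclideanSpace ℝ (Fin d) => M.Q i j z.1 z.2.1 z.2.2)
    (Icc 0 M.T ×ˢ univ ×ˢ simplex d)
  Q_lipschitz : ∃ C : ℝ, ∀ i j, ∀ t ∈ Icc 0 M.T, ∀ s ∈ Icc 0 M.T, ∀ a,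
    ∀ m ∈ simplex d, ∀ p ∈ simplex d,
      |M.Q i j t a m - M.Q i j s a p| ≤ C * (|t - s| + ‖m - p‖)
  F_continuous : ContinuousOn
    (fun z : ℝ × (Fin d → A) × EuclideanSpace ℝ (Fin d) => M.F z.1 z.2.1 z.2.2)
    (Icc 0 M.T ×ˢ univ ×ˢ simplex d)
  F_lipschitz : ∃ C : ℝ, ∀ t ∈ Icc 0 M.T, ∀ s ∈ Icc 0 M.T, ∀ a,
    ∀ m ∈ simplex d, ∀ p ∈ simplex d,
      |M.F t a m - M.F s a p| ≤ C * (|t - s| + ‖m - p‖)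
  G_lipschitz : ∃ C : ℝ, ∀ m ∈ simplex d, ∀ p ∈ simplex d,
    |M.G m - M.G p| ≤ C * ‖m - p‖

/-! ### The `N`-agent problem, in terms of the empirical measure -/

/-- The generator at time `t` and point `m`, under the actions `a ∈ A^d` (one for each private
state), of the empirical measure of `N` agents: it jumps from `m` to `m + (δ_j - δ_i) / N` at rate
`N m_i Q_{ij}(t, a^i, m)`. If `m ∈ S_d^N` but the target is not in `S_d^N`, then `m_i = 0`. -/
noncomputable def generator (M : Model d A) (N : ℕ) (t : ℝ) (a : Fin d → A)
    (v : EuclideanSpace ℝ (Fin d) → ℝ) (m : EuclideanSpace ℝ (Fin d)) : ℝ :=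
  N * ∑ i, ∑ j, m i * M.Q i j t (a i) m *
    (v (m + (1 / (N : ℝ)) • (EuclideanSpace.single j 1 - EuclideanSpace.single i 1)) - v m)

/-- `P` is the transition function of the time-inhomogeneous Markov chain on `S_d^N` controlled by
the feedback `α`, i.e. `P s r x y` is the probability to be in `y` at time `r` given that the chain
is in `x` at time `s`. The transition rates are imposed through Kolmogorov's forward equation
`∂_r P_{s,r} v = P_{s,r} L_r v`, in integrated form since `α` is only measurable in time. -/
structure IsTransitionFunction (M : Model d A) (N : ℕ) (α : ℝ → Grid d N → Fin d → A)
    (P : ℝ → ℝ → Matrix (Grid d N) (Grid d N) ℝ) : Prop where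
  nonneg : ∀ s r, 0 ≤ s → s ≤ r → r ≤ M.T → ∀ x y, 0 ≤ P s r x y
  sum_eq_one : ∀ s r, 0 ≤ s → s ≤ r → r ≤ M.T → ∀ x, ∑ y, P s r x y = 1
  self : ∀ s ∈ Icc 0 M.T, P s s = 1
  chapman_kolmogorov : ∀ s u r, 0 ≤ s → s ≤ u → u ≤ r → r ≤ M.T → P s r = P s u * P u r
  continuous : ∀ s ∈ Icc 0 M.T, ∀ x y, ContinuousOn (fun r => P s r x y) (Icc s M.T)
  forward : ∀ s r, 0 ≤ s → s ≤ r → r ≤ M.T → ∀ (v : EuclideanSpace ℝ (Fin d) → ℝ) (x : Grid d N),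
    ∑ y, P s r x y * v y =
      v x + ∫ u in s..r, ∑ y, P s u x y * M.generator N u (α u y) v y

/-- The expected cost `E[∫_t^T F(s, α(s, μ_s), μ_s) ds + G(μ_T)]` of the controlled chain `μ`
with transition function `P`, started from `x` at time `t`. -/
noncomputable def costN (M : Model d A) (N : ℕ) (α : ℝ → Grid d N → Fin d → A)
    (P : ℝ → ℝ → Matrix (Grid d N) (Grid d N) ℝ) (t : ℝ) (x : Grid d N) : ℝ :=
  (∫ s in t..M.T, ∑ y, P t s x y * M.F s (α s y) y) + ∑ y, P t M.T x y * M.G y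

/-- The value function `V^N` of the `N`-agent problem: the infimum of the expected cost over all
measurable feedback controls `α(t, i, m)`. -/
noncomputable def valueN [MeasurableSpace A] (M : Model d A) (N : ℕ) (t : ℝ) (x : Grid d N) : ℝ :=
  sInf {J : ℝ | ∃ (α : ℝ → Grid d N → Fin d → A) (P : ℝ → ℝ → Matrix (Grid d N) (Grid d N) ℝ),
    (∀ y, Measurable fun s => α s y) ∧ M.IsTransitionFunction N α P ∧ J = M.costN N α P t x}

/-! ### The mean field control problem -/

/-- The `i`-th component of the velocity of the law of the representative agent. -/
def drift (M : Model d A) (t : ℝ) (a : Fin d → A) (m : EuclideanSpace ℝ (Fin d)) (i : Fin d) : ℝ :=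
  ∑ j, (m j * M.Q j i t (a j) m - m i * M.Q i j t (a i) m)

/-- `μ` is the (Carathéodory) solution on `[t, T]` of `dμ^i/ds = drift^i(s, α(s), μ_s)`, `μ_t = m`,
in the simplex. -/
structure IsTrajectory (M : Model d A) (α : ℝ → Fin d → A) (t : ℝ)
    (m : EuclideanSpace ℝ (Fin d)) (μ : ℝ → EuclideanSpace ℝ (Fin d)) : Prop where
  continuous : ContinuousOn μ (Icc t M.T)
  mem_simplex : ∀ s ∈ Icc t M.T, μ s ∈ simplex d
  integral_eq : ∀ s ∈ Icc t M.T, ∀ i, μ s i = m i + ∫ r in t..s, M.drift r (α r) (μ r) i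

/-- The cost `∫_t^T F(s, α(s), μ_s) ds + G(μ_T)` of a control and its trajectory. -/
noncomputable def cost (M : Model d A) (α : ℝ → Fin d → A) (μ : ℝ → EuclideanSpace ℝ (Fin d))
    (t : ℝ) : ℝ :=
  (∫ s in t..M.T, M.F s (α s) (μ s)) + M.G (μ M.T)

/-- The value function `V` of the mean field control problem: the infimum of the cost over all
measurable controls `α : [0, T] → A^d`. -/
noncomputable def value [MeasurableSpace A] (M : Model d A) (t : ℝ)
    (m : EuclideanSpace ℝ (Fin d)) : ℝ :=
  sInf {J : ℝ | ∃ (α : ℝ → Fin d → A) (μ : ℝ → EuclideanSpace ℝ (Fin d)),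
    Measurable α ∧ M.IsTrajectory α t m μ ∧ J = M.cost α μ t}

end Model

end MFC

/-!
Neither value function is shown to solve a Hamilton-Jacobi equation, and no process is built on a
path space. The two problems are compared through one-step estimates for transition functions.

*The coupling.* Let the chain start from `x` at time `s`, let a feedback `α` drive it, and let a
mean field trajectory `μ` start from `y` and use the control `u ↦ α u x`, that is, the action which
the feedback prescribes at the starting point of the chain. Over a time step of length `h` the chain
leaves `x` with probability `O(N h)` only, the drift of the chain is the velocity of the
trajectory, and each jump has size `O(1 / N)`. Hence (`IsTransitionFunction.sum_sq_dist_le`)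
the expected squared distance grows from `‖x - y‖²` to at most
`(1 + 2 K h) ‖x - y‖² + 4 K h / N + O(N h²)`, and
(`IsTransitionFunction.abs_integral_F_sub_le`) the running costs differ by at most
`K h ‖x - y‖ + O(N h²)`.

*Backward induction.* A bound `a + θ ‖x - y‖²` for the difference of two costs therefore passes from
time `s + h` to `s` with slightly larger `a` and `θ` (`IsTransitionFunction.step_le`). It
starts from the terminal cost, since `K r ≤ K ε + K r² / ε`; so `θ` is of order `1 / ε`, and
after the passage `h → 0` with `N` fixed (`backward_induction`) the terms `O(N h²)` vanish and, for
`x = y`, an error of order `ε + 1 / (N ε)` remains. The choice `ε = 1 / √N` gives the rate.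

*Both inequalities.* For `V ≤ V^N + C / √N` the step is combined with the dynamic programming
inequality `value_le_integral_add_value`, which needs only the concatenation of controls. For
`V^N ≤ V + C / √N` a deterministic control is used as a feedback, with the given trajectory.
Convexity plays no role, as no control is ever averaged.

*Nondegeneracy.* The infima range over nonempty sets that are bounded below: trajectories
(`exists_isTrajectory`) and transition functions (`exists_isTransitionFunction`) exist for every
measurable control. Both come from `exists_solution_in_convex`, a Carathéodory theorem with an
invariant convex set, here the simplex of probability vectors. The maximum is attained since, for
fixed `N` and `m`, both value functions are Lipschitz in time.
-/

namespace MFC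

open MeasureTheory

/-! ### Integral equations with coefficients measurable in time -/

/-- The nearest-point map onto a closed convex set of a Hilbert space is `1`-Lipschitz. -/
theorem exists_lipschitz_retraction {E : Type*} [NormedAddCommGroup E] [InnerProductSpace ℝ E]
    [CompleteSpace E] {K : Set E} (hne : K.Nonempty) (hcl : IsClosed K) (hcv : Convex ℝ K) :
    ∃ p : E → E, (∀ x, p x ∈ K) ∧ (∀ x ∈ K, p x = x) ∧ ∀ x y, ‖p x - p y‖ ≤ ‖x - y‖ := by
  have h : ∀ x : E, ∃ v ∈ K, ∀ w ∈ K, inner ℝ (x - v) (w - v) ≤ 0 := fun x => by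
    obtain ⟨v, hv, hx⟩ := exists_norm_eq_iInf_of_complete_convex hne hcl.isComplete hcv x
    exact ⟨v, hv, (norm_eq_iInf_iff_real_inner_le_zero hcv hv).1 hx⟩
  choose p hpK hp using h
  refine ⟨p, hpK, fun x hx => ?_, fun x y => ?_⟩
  · have := hp x x hx
    rw [real_inner_self_nonpos, sub_eq_zero] at this
    exact this.symm
  · have h1 := hp x (p y) (hpK y)
    have h2 := hp y (p x) (hpK x)
    have h3 : inner ℝ (x - y) (p x - p y) = inner ℝ (p x - p y) (p x - p y)
        - inner ℝ (x - p x) (p y - p x) - inner ℝ (y - p y) (p x - p y) := by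
      simp only [inner_sub_left, inner_sub_right]; ring
    have h4 := real_inner_le_norm (x - y) (p x - p y)
    rw [real_inner_self_eq_norm_sq] at h3
    rcases eq_or_lt_of_le (norm_nonneg (p x - p y)) with h0 | h0
    · rw [← h0]; positivity
    · nlinarith

/-- Grönwall's inequality in integral form, for a function that need not be differentiable. -/
theorem gronwall_integral {δ : ℝ → ℝ} {a b c L : ℝ} (hδ : ContinuousOn δ (Icc a b)) (hc : 0 ≤ c)
    (hL : 0 ≤ L) (h0 : ∀ s ∈ Icc a b, 0 ≤ δ s)
    (h : ∀ s ∈ Icc a b, δ s ≤ c + L * ∫ r in a..s, δ r) :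
    ∀ s ∈ Icc a b, δ s ≤ c * Real.exp (L * (s - a)) := by
  intro s hs
  have hab : a ≤ b := hs.1.trans hs.2
  -- extended by constants, `δ` is continuous on the line, and its primitive is differentiable
  have hcont : Continuous (IccExtend hab ((Icc a b).domRestrict δ)) :=
    hδ.domRestrict.Icc_extend'
  set ε := IccExtend hab ((Icc a b).domRestrict δ) with hε
  have hεδ : ∀ r ∈ Icc a b, ε r = δ r := fun r hr => by
    rw [hε, IccExtend_of_mem _ _ hr]; rfl
  have hint : ∀ r ∈ Icc a b, ∫ u in a..r, ε u = ∫ u in a..r, δ u := fun r hr => by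
    refine intervalIntegral.integral_congr fun u hu => hεδ u ?_
    rw [uIcc_of_le hr.1] at hu
    exact ⟨hu.1, hu.2.trans hr.2⟩
  have hder : ∀ r, HasDerivAt (fun r => c + L * ∫ u in a..r, ε u) (L * ε r) r := fun r =>
    ((intervalIntegral.integral_hasDerivAt_right (hcont.intervalIntegrable _ _)
      (hcont.stronglyMeasurableAtFilter _ _) hcont.continuousAt).const_mul L).const_add c
  have hnn : ∀ r ∈ Icc a b, 0 ≤ ∫ u in a..r, ε u := fun r hr => by
    refine intervalIntegral.integral_nonneg hr.1 fun u hu => ?_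
    rw [hεδ u ⟨hu.1, hu.2.trans hr.2⟩]
    exact h0 u ⟨hu.1, hu.2.trans hr.2⟩
  have key := norm_le_gronwallBound_of_norm_deriv_right_le (f := fun r => c + L * ∫ u in a..r, ε u)
    (f' := fun r => L * ε r) (δ := c) (K := L) (ε := 0) (a := a) (b := b)
    (fun r _ => (hder r).continuousAt.continuousWithinAt)
    (fun r _ => (hder r).hasDerivWithinAt) (by simp [abs_of_nonneg hc])
    (fun r hr => by
      have hr' : r ∈ Icc a b := ⟨hr.1, hr.2.le⟩
      have h1 := hnn r hr'
      rw [Real.norm_of_nonneg (by rw [hεδ r hr']; exact mul_nonneg hL (h0 r hr')),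
        Real.norm_of_nonneg (by positivity), add_zero, hεδ r hr', hint r hr']
      exact mul_le_mul_of_nonneg_left (h r hr') hL) s hs
  rw [gronwallBound_ε0] at key
  refine le_trans ?_ key
  refine le_trans ?_ (Real.le_norm_self _)
  change δ s ≤ c + L * ∫ u in a..s, ε u
  rw [hint s hs]
  exact h s hs

theorem intervalIntegrable_of_le_continuous {E : Type*} [NormedAddCommGroup E]
    [MeasurableSpace E] [BorelSpace E] [SecondCountableTopology E] {f : ℝ → E} (hf : Measurable f)
    {φ : ℝ → ℝ} (hφ : Continuous φ) (hB : ∀ r, ‖f r‖ ≤ φ r) (a b : ℝ) :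
    IntervalIntegrable f volume a b := by
  refine (hφ.intervalIntegrable a b).mono_fun hf.aestronglyMeasurable ?_
  exact Filter.Eventually.of_forall fun r => (hB r).trans (Real.le_norm_self _)

section Caratheodory

variable {E : Type*} [NormedAddCommGroup E] [NormedSpace ℝ E] [FiniteDimensional ℝ E]
  [MeasurableSpace E] [BorelSpace E]

/-- A Carathéodory function (measurable in time, Lipschitz in space) is measurable along measurable
curves. -/
theorem measurable_comp_of_lipschitz {g : ℝ → E → E} (hg : ∀ x, Measurable fun r => g r x) {L : ℝ}
    (hL : ∀ r x y, ‖g r x - g r y‖ ≤ L * ‖x - y‖) {w : ℝ → E} (hw : Measurable w) :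
    Measurable fun r => g r (w r) := by
  have hc : ∀ r, Continuous (g r) := fun r =>
    (LipschitzWith.of_dist_le' (K := L) fun x y => by
      simpa [dist_eq_norm] using hL r x y).continuous
  have h : Measurable (Function.uncurry fun (x : E) (r : ℝ) => g r x) :=
    measurable_uncurry_of_continuous_of_measurable hc hg
  exact h.comp (hw.prodMk measurable_id)

/-- Global existence for an integral equation whose field is Lipschitz in space and only measurable
in time. In the unknown `exp (-c (s - a)) • u s`, with `c > L`, the Picard map is a contraction for
the supremum norm. -/
theorem exists_caratheodory_solution {g : ℝ → E → E} (hg : ∀ x, Measurable fun r => g r x)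
    {L B : ℝ} (hL0 : 0 ≤ L) (hL : ∀ r x y, ‖g r x - g r y‖ ≤ L * ‖x - y‖)
    (hB : ∀ r, ‖g r 0‖ ≤ B) {a b : ℝ} (hab : a ≤ b) (x₀ : E) :
    ∃ u : ℝ → E, Continuous u ∧ ∀ s ∈ Icc a b, u s = x₀ + ∫ r in a..s, g r (u r) := by
  have := FiniteDimensional.proper ℝ E
  have := FiniteDimensional.complete ℝ E
  have hgrow : ∀ r x, ‖g r x‖ ≤ B + L * ‖x‖ := fun r x => by
    have h1 := hL r x 0
    have h2 := norm_sub_norm_le (g r x) (g r 0)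
    rw [sub_zero] at h1
    linarith [hB r]
  set c : ℝ := L + 1 with hc
  have hc0 : 0 < c := by positivity
  -- a continuous function `v` on `[a, b]`, rescaled to the candidate solution
  let lift : C(Icc a b, E) → ℝ → E := fun v r => Real.exp (c * (r - a)) • v (projIcc a b hab r)
  have hlift : ∀ v, Continuous (lift v) := fun v => by
    have := v.continuous.comp (continuous_projIcc (h := hab))
    exact (by fun_prop : Continuous fun r : ℝ => Real.exp (c * (r - a))).smul this
  have hint : ∀ v p q, IntervalIntegrable (fun r => g r (lift v r)) volume p q := fun v p q =>
    intervalIntegrable_of_le_continuous (measurable_comp_of_lipschitz hg hL (hlift v).measurable)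
      (continuous_const.add (continuous_const.mul (hlift v).norm))
      (fun r => (hgrow r _).trans_eq rfl) p q
  have hprim : ∀ v, Continuous fun s => ∫ r in a..s, g r (lift v r) := fun v =>
    intervalIntegral.continuous_primitive (hint v) a
  let Ψ : C(Icc a b, E) → C(Icc a b, E) := fun v =>
    ⟨fun s => Real.exp (-(c * ((s : ℝ) - a))) • (x₀ + ∫ r in a..s, g r (lift v r)), by
      have := (hprim v).comp (continuous_subtype_val (p := fun s => s ∈ Icc a b))
      exact (by fun_prop : Continuous fun s : Icc a b => Real.exp (-(c * ((s : ℝ) - a)))).smul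
        (continuous_const.add this)⟩
  have hLc : 0 ≤ L / c := by positivity
  have hΨ : ContractingWith (L / c).toNNReal Ψ := by
    refine ⟨?_, LipschitzWith.of_dist_le_mul fun v w => ?_⟩
    · rw [← NNReal.coe_lt_coe, Real.coe_toNNReal _ hLc, NNReal.coe_one, div_lt_one hc0]
      linarith
    · rw [Real.coe_toNNReal _ hLc]
      rw [ContinuousMap.dist_le (mul_nonneg hLc dist_nonneg)]
      intro s
      change dist (Real.exp (-(c * ((s : ℝ) - a))) • (x₀ + ∫ r in a..s, g r (lift v r)))
        (Real.exp (-(c * ((s : ℝ) - a))) • (x₀ + ∫ r in a..s, g r (lift w r))) ≤ L / c * dist v w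
      rw [dist_eq_norm, ← smul_sub, add_sub_add_left_eq_sub,
        ← intervalIntegral.integral_sub (hint v _ _) (hint w _ _), norm_smul,
        Real.norm_of_nonneg (Real.exp_nonneg _)]
      have hs : a ≤ (s : ℝ) := s.2.1
      have h1 : ‖∫ r in a..s, g r (lift v r) - g r (lift w r)‖
          ≤ ∫ r in a..s, L * dist v w * Real.exp (c * (r - a)) := by
        refine intervalIntegral.norm_integral_le_of_norm_le hs
          (Filter.Eventually.of_forall fun r _ => ?_)
          ((by fun_prop : Continuous fun r : ℝ =>
            L * dist v w * Real.exp (c * (r - a))).intervalIntegrable _ _)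
        refine (hL r _ _).trans ?_
        rw [mul_assoc]
        refine mul_le_mul_of_nonneg_left ?_ hL0
        change ‖Real.exp (c * (r - a)) • v (projIcc a b hab r)
          - Real.exp (c * (r - a)) • w (projIcc a b hab r)‖ ≤ _
        rw [← smul_sub, norm_smul, Real.norm_of_nonneg (Real.exp_nonneg _), mul_comm,
          ← dist_eq_norm]
        exact mul_le_mul_of_nonneg_right (ContinuousMap.dist_apply_le_dist _) (Real.exp_nonneg _)
      have h2 : ∫ r in a..(s : ℝ), L * dist v w * Real.exp (c * (r - a))
          = L * dist v w * ((Real.exp (c * (s - a)) - 1) / c) := by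
        have hd : ∀ r ∈ uIcc a (s : ℝ), HasDerivAt
            (fun r => L * dist v w * (Real.exp (c * (r - a)) / c))
            (L * dist v w * Real.exp (c * (r - a))) r := fun r _ => by
          have : HasDerivAt (fun r => c * (r - a)) (c * 1) r :=
            ((hasDerivAt_id r).sub_const a).const_mul c
          have := ((this.exp).div_const c).const_mul (L * dist v w)
          refine this.congr_deriv ?_
          field_simp
        rw [intervalIntegral.integral_eq_sub_of_hasDerivAt hd
          ((by fun_prop : Continuous fun r : ℝ =>
            L * dist v w * Real.exp (c * (r - a))).intervalIntegrable _ _)]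
        simp
        ring
      rw [h2] at h1
      calc Real.exp (-(c * (s - a))) * ‖∫ r in a..s, g r (lift v r) - g r (lift w r)‖
          ≤ Real.exp (-(c * (s - a))) * (L * dist v w * (Real.exp (c * (s - a)) / c)) := by
            refine mul_le_mul_of_nonneg_left (h1.trans ?_) (Real.exp_nonneg _)
            gcongr
            linarith
        _ = (Real.exp (-(c * (s - a))) * Real.exp (c * (s - a))) * (L / c * dist v w) := by ring
        _ = L / c * dist v w := by rw [← Real.exp_add]; simp
  have hfix : Ψ (hΨ.fixedPoint Ψ) = hΨ.fixedPoint Ψ := hΨ.fixedPoint_isFixedPt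
  refine ⟨lift (hΨ.fixedPoint Ψ), hlift _, fun s hs => ?_⟩
  have h1 := congrArg (fun v : C(Icc a b, E) => v ⟨s, hs⟩) hfix
  change Real.exp (c * (s - a)) • (hΨ.fixedPoint Ψ) (projIcc a b hab s) = _
  rw [projIcc_of_mem hab hs]
  rw [← h1]
  change Real.exp (c * (s - a)) • (Real.exp (-(c * (s - a))) • (x₀ + _)) = _
  rw [smul_smul, ← Real.exp_add]
  simp

end Caratheodory

/-- A solution of `w' = p - lam w` with `p ≥ 0` and `w a ≥ 0` stays nonnegative: after its last
nonnegative time it would have to increase. -/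
theorem nonneg_of_relaxation {w p : ℝ → ℝ} {a b lam : ℝ} (hlam : 0 ≤ lam)
    (hw : ContinuousOn w (Icc a b)) (ha : 0 ≤ w a) (hp : ∀ r ∈ Icc a b, 0 ≤ p r)
    (hi : ∀ s ∈ Icc a b, IntervalIntegrable (fun r => p r - lam * w r) volume a s)
    (h : ∀ s ∈ Icc a b, w s = w a + ∫ r in a..s, (p r - lam * w r)) :
    ∀ s ∈ Icc a b, 0 ≤ w s := by
  intro s hs
  by_contra hneg
  push Not at hneg
  -- `t` is the last time before `s` at which `w` is nonnegative
  have hws : ContinuousOn w (Icc a s) := hw.mono (Icc_subset_Icc_right hs.2)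
  have hS : IsCompact (Icc a s ∩ w ⁻¹' Ici 0) :=
    isCompact_Icc.of_isClosed_subset (hws.preimage_isClosed_of_isClosed isClosed_Icc isClosed_Ici)
      inter_subset_left
  obtain ⟨t, ⟨htI, ht0⟩, htmax⟩ := hS.exists_isGreatest ⟨a, ⟨left_mem_Icc.2 hs.1, ha⟩⟩
  have htb : t ∈ Icc a b := ⟨htI.1, htI.2.trans hs.2⟩
  have h1 : w s = w t + ∫ r in t..s, (p r - lam * w r) := by
    rw [h s hs, h t htb, ← intervalIntegral.integral_interval_sub_left (hi s hs) (hi t htb)]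
    ring
  have h2 : 0 ≤ ∫ r in t..s, (p r - lam * w r) := by
    refine intervalIntegral.integral_nonneg_of_ae_restrict htI.2 ?_
    have hne : ∀ᵐ r ∂(volume.restrict (Icc t s)), r ≠ t :=
      ae_restrict_of_ae (by simp [ae_iff])
    filter_upwards [hne, ae_restrict_mem measurableSet_Icc] with r hr1 hr
    have hr' : r ∈ Icc a s := ⟨htI.1.trans hr.1, hr.2⟩
    have hwr : w r < 0 := by
      by_contra hcon
      push Not at hcon
      exact hr1 (le_antisymm (htmax ⟨hr', hcon⟩) hr.1)
    have := hp r ⟨hr'.1, hr'.2.trans hs.2⟩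
    have := mul_nonneg hlam (neg_nonneg.2 hwr.le)
    change 0 ≤ p r - lam * w r
    linarith
  have : 0 ≤ w t := ht0
  linarith

/-- A curve that relaxes towards points of a closed convex set never leaves this set. By separation,
this reduces to the scalar case. -/
theorem mem_of_relaxation {E : Type*} [NormedAddCommGroup E] [NormedSpace ℝ E] [CompleteSpace E]
    {K : Set E} (hcl : IsClosed K) (hcv : Convex ℝ K) {u z : ℝ → E} {a b lam : ℝ} (hlam : 0 ≤ lam)
    (hu : ContinuousOn u (Icc a b)) (ha : u a ∈ K) (hz : ∀ r ∈ Icc a b, z r ∈ K)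
    (hi : ∀ s ∈ Icc a b, IntervalIntegrable (fun r => lam • (z r - u r)) volume a s)
    (h : ∀ s ∈ Icc a b, u s = u a + ∫ r in a..s, lam • (z r - u r)) :
    ∀ s ∈ Icc a b, u s ∈ K := by
  intro s hs
  by_contra hn
  obtain ⟨f, c, h1, h2⟩ := geometric_hahn_banach_point_closed hcv hcl hn
  have e : ∀ r, lam * (f (z r) - c) - lam * (f (u r) - c) = f (lam • (z r - u r)) := fun r => by
    simp; ring
  have := nonneg_of_relaxation (w := fun r => f (u r) - c) (p := fun r => lam * (f (z r) - c)) hlam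
    ((f.continuous.comp_continuousOn hu).sub continuousOn_const)
    (sub_nonneg.2 (h2 _ ha).le)
    (fun r hr => mul_nonneg hlam (sub_nonneg.2 (h2 _ (hz r hr)).le))
    (fun s hs => by
      simp only [e]
      exact ⟨f.integrable_comp (hi s hs).1, f.integrable_comp (hi s hs).2⟩)
    (fun s hs => by
      simp only [e]
      rw [f.intervalIntegral_comp_comm (hi s hs)]
      conv_lhs => rw [h s hs, map_add]
      ring) s hs
  linarith

/-- Existence of a solution in a closed convex set `K`, for a field that is defined on `K` and whose
Euler step of size `1 / lam` maps `K` to itself. -/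
theorem exists_solution_in_convex {E : Type*} [NormedAddCommGroup E] [InnerProductSpace ℝ E]
    [FiniteDimensional ℝ E] [MeasurableSpace E] [BorelSpace E]
    {K : Set E} (hcl : IsClosed K) (hcv : Convex ℝ K) {g : ℝ → E → E}
    (hg : ∀ x ∈ K, Measurable fun r => g r x) {L B lam : ℝ} (hL0 : 0 ≤ L)
    (hL : ∀ r, ∀ x ∈ K, ∀ y ∈ K, ‖g r x - g r y‖ ≤ L * ‖x - y‖)
    (hB : ∀ r, ∀ x ∈ K, ‖g r x‖ ≤ B) (hlam : 0 < lam)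
    (hinv : ∀ r, ∀ x ∈ K, x + lam⁻¹ • g r x ∈ K)
    {a b : ℝ} (hab : a ≤ b) {x₀ : E} (hx₀ : x₀ ∈ K) :
    ∃ u : ℝ → E, Continuous u ∧ (∀ s ∈ Icc a b, u s ∈ K) ∧
      ∀ s ∈ Icc a b, u s = x₀ + ∫ r in a..s, g r (u r) := by
  have := FiniteDimensional.complete ℝ E
  obtain ⟨p, hpK, hpid, hpL⟩ := exists_lipschitz_retraction ⟨x₀, hx₀⟩ hcl hcv
  -- outside `K` the field is extended by `g r (p x) + lam • (p x - x)`, which relaxes to `K`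
  have hmeas : ∀ x, Measurable fun r => g r (p x) + lam • (p x - x) := fun x =>
    (hg _ (hpK x)).add_const _
  -- the solution stays in `K`, where both fields agree
  obtain ⟨u, hu, hsol⟩ := exists_caratheodory_solution
    (g := fun r x => g r (p x) + lam • (p x - x)) hmeas
    (L := L + 2 * lam) (B := B + ‖lam • (p 0 - 0)‖) (by positivity) (fun r x y => by
      have e : g r (p x) + lam • (p x - x) - (g r (p y) + lam • (p y - y))
          = (g r (p x) - g r (p y)) + lam • ((p x - p y) - (x - y)) := by module
      have h1 := hL r _ (hpK x) _ (hpK y)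
      have h2 := hpL x y
      have h3 : ‖lam • ((p x - p y) - (x - y))‖ ≤ lam * (2 * ‖x - y‖) := by
        rw [norm_smul, Real.norm_of_nonneg hlam.le]
        gcongr
        exact (norm_sub_le _ _).trans (by linarith)
      rw [e]
      have h4 := mul_le_mul_of_nonneg_left h2 hL0
      calc _ ≤ _ := norm_add_le _ _
        _ ≤ (L + 2 * lam) * ‖x - y‖ := by linarith)
    (fun r => (norm_add_le _ _).trans (add_le_add_left (hB r _ (hpK 0)) _)) hab x₀
  have hua : u a = x₀ := by simpa using hsol a (left_mem_Icc.2 hab)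
  have e : ∀ r, lam • ((p (u r) + lam⁻¹ • g r (p (u r))) - u r)
      = g r (p (u r)) + lam • (p (u r) - u r) := fun r => by
    rw [add_sub_right_comm, smul_add, smul_inv_smul₀ hlam.ne', add_comm]
  have hpu : Continuous fun r => p (u r) :=
    (LipschitzWith.of_dist_le' (K := 1) fun x y => by
      simpa [dist_eq_norm] using hpL x y).continuous.comp hu
  have hmem : ∀ s ∈ Icc a b, u s ∈ K := by
    refine mem_of_relaxation hcl hcv (z := fun r => p (u r) + lam⁻¹ • g r (p (u r))) hlam.le
      hu.continuousOn (hua ▸ hx₀) (fun r _ => hinv r _ (hpK _)) (fun s _ => ?_) (fun s hs => ?_)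
    · simp only [e]
      have h1 : Measurable fun r => g r (p (u r)) :=
        measurable_comp_of_lipschitz (g := fun r x => g r (p x)) (fun x => hg _ (hpK x)) (L := L)
          (fun r x y => (hL r _ (hpK x) _ (hpK y)).trans
            (mul_le_mul_of_nonneg_left (hpL x y) hL0)) hu.measurable
      refine (intervalIntegrable_of_le_continuous h1 (continuous_const (y := B))
        (fun r => hB r _ (hpK _)) _ _).add
        ((continuous_const.smul (hpu.sub hu)).intervalIntegrable _ _)
    · simp only [e]
      rw [hua]
      exact hsol s hs
  refine ⟨u, hu, hmem, fun s hs => ?_⟩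
  rw [hsol s hs]
  congr 1
  refine intervalIntegral.integral_congr fun r hr => ?_
  rw [uIcc_of_le hs.1] at hr
  have := hpid _ (hmem r ⟨hr.1, hr.2.trans hs.2⟩)
  simp [this]

/-- Stability, and in particular uniqueness, of solutions with values in `K`. -/
theorem norm_sub_le_of_integral_equation {E : Type*} [NormedAddCommGroup E] [NormedSpace ℝ E]
    {g : ℝ → E → E} {K : Set E} {L : ℝ} (hL0 : 0 ≤ L) {a b : ℝ}
    (hL : ∀ r ∈ Icc a b, ∀ x ∈ K, ∀ y ∈ K, ‖g r x - g r y‖ ≤ L * ‖x - y‖)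
    {u v : ℝ → E} (hu : ContinuousOn u (Icc a b)) (hv : ContinuousOn v (Icc a b))
    (huK : ∀ s ∈ Icc a b, u s ∈ K) (hvK : ∀ s ∈ Icc a b, v s ∈ K)
    (hui : IntervalIntegrable (fun r => g r (u r)) volume a b)
    (hvi : IntervalIntegrable (fun r => g r (v r)) volume a b)
    (hus : ∀ s ∈ Icc a b, u s = u a + ∫ r in a..s, g r (u r))
    (hvs : ∀ s ∈ Icc a b, v s = v a + ∫ r in a..s, g r (v r)) :
    ∀ s ∈ Icc a b, ‖u s - v s‖ ≤ ‖u a - v a‖ * Real.exp (L * (s - a)) := by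
  intro s hs
  refine gronwall_integral (δ := fun s => ‖u s - v s‖) (hu.sub hv).norm (norm_nonneg _) hL0
    (fun _ _ => norm_nonneg _)
    (fun r hr => ?_) s hs
  have hsub : uIcc a r ⊆ uIcc a b := by
    rw [uIcc_of_le hr.1, uIcc_of_le (hr.1.trans hr.2)]
    exact Icc_subset_Icc_right hr.2
  rw [hus r hr, hvs r hr, add_sub_add_comm,
    ← intervalIntegral.integral_sub (hui.mono_set hsub) (hvi.mono_set hsub)]
  refine (norm_add_le _ _).trans (add_le_add_right ?_ _)
  rw [← intervalIntegral.integral_const_mul]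
  refine intervalIntegral.norm_integral_le_of_norm_le hr.1
    (Filter.Eventually.of_forall fun q hq => ?_) ?_
  · have hq' : q ∈ Icc a b := ⟨hq.1.le, hq.2.trans hr.2⟩
    exact hL q hq' _ (huK q hq') _ (hvK q hq')
  · refine ContinuousOn.intervalIntegrable ?_
    rw [uIcc_of_le hr.1]
    exact (continuousOn_const.mul (hu.sub hv).norm).mono (Icc_subset_Icc_right hr.2)

/-! ### The simplex, bounds for the model, and existence of trajectories -/

/-- The probability vectors on a finite type. -/
def probVectors (ι : Type*) [Fintype ι] : Set (EuclideanSpace ℝ ι) :=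
  {p | (∀ i, 0 ≤ p i) ∧ ∑ i, p i = 1}

theorem probVectors_isClosed {ι : Type*} [Fintype ι] : IsClosed (probVectors ι) := by
  have h : ∀ i, Continuous fun p : EuclideanSpace ℝ ι => p i := fun i => by fun_prop
  have h' : IsClosed {p : EuclideanSpace ℝ ι | ∀ i, 0 ≤ p i} := by
    simp only [ofPred_forall]
    exact isClosed_iInter fun i => isClosed_le continuous_const (h i)
  exact h'.inter (isClosed_eq (by fun_prop) continuous_const)

theorem probVectors_convex {ι : Type*} [Fintype ι] : Convex ℝ (probVectors ι) := by
  intro x hx y hy a b ha hb hab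
  refine ⟨fun i => ?_, ?_⟩
  · have := hx.1 i
    have := hy.1 i
    simp only [PiLp.add_apply, PiLp.smul_apply, smul_eq_mul]
    positivity
  · simp only [PiLp.add_apply, PiLp.smul_apply, smul_eq_mul, Finset.sum_add_distrib,
      ← Finset.mul_sum, hx.2, hy.2, mul_one, hab]

theorem simplex_isCompact (d : ℕ) : IsCompact (simplex d) := by
  have h : simplex d = (EuclideanSpace.equiv (Fin d) ℝ).symm '' stdSimplex ℝ (Fin d) := by
    ext m
    refine ⟨fun hm => ⟨m.ofLp, hm, rfl⟩, ?_⟩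
    rintro ⟨x, hx, rfl⟩
    exact hx
  rw [h]
  exact (isCompact_stdSimplex ℝ (Fin d)).image (EuclideanSpace.equiv (Fin d) ℝ).symm.continuous

theorem simplex_convex (d : ℕ) : Convex ℝ (simplex d) :=
  probVectors_convex

theorem simplex_le_one {d : ℕ} {m : EuclideanSpace ℝ (Fin d)} (hm : m ∈ simplex d) (i : Fin d) :
    m i ≤ 1 := by
  rw [← hm.2]
  exact Finset.single_le_sum (fun j _ => hm.1 j) (Finset.mem_univ i)

theorem simplex_abs_le_one {d : ℕ} {m : EuclideanSpace ℝ (Fin d)} (hm : m ∈ simplex d) (i : Fin d) :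
    |m i| ≤ 1 := by
  rw [abs_of_nonneg (hm.1 i)]
  exact simplex_le_one hm i

/-- Measurability in time of a function that is continuous on the domain of the model only, along a
measurable control and a continuous curve in the simplex. -/
theorem measurable_indicator_along {d : ℕ} {X Z : Type*} [TopologicalSpace X]
    [SecondCountableTopology X] [MeasurableSpace X] [BorelSpace X] [TopologicalSpace Z] [Zero Z]
    [MeasurableSpace Z] [BorelSpace Z] {φ : ℝ → X → EuclideanSpace ℝ (Fin d) → Z} {t T : ℝ}
    (hφ : ContinuousOn (fun z : ℝ × X × EuclideanSpace ℝ (Fin d) => φ z.1 z.2.1 z.2.2)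
      (Icc 0 T ×ˢ univ ×ˢ simplex d)) (ht : 0 ≤ t) {α : ℝ → X} (hα : Measurable α)
    {μ : ℝ → EuclideanSpace ℝ (Fin d)} (hμ : ContinuousOn μ (Icc t T))
    (hμS : ∀ s ∈ Icc t T, μ s ∈ simplex d) :
    Measurable ((Icc t T).indicator fun s => φ s (α s) (μ s)) := by
  classical
  have hS : MeasurableSet (Icc 0 T ×ˢ (univ : Set X) ×ˢ simplex d) :=
    measurableSet_Icc.prod (MeasurableSet.univ.prod (simplex_isCompact d).measurableSet)
  have h1 := hφ.measurable_piecewise (g := fun _ => 0) continuousOn_const hS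
  have h2 := hμ.measurable_piecewise (g := fun _ => 0) continuousOn_const measurableSet_Icc
  have h3 := (h1.comp (measurable_id.prodMk (hα.prodMk h2))).indicator
    (measurableSet_Icc (a := t) (b := T))
  convert h3 using 1
  funext s
  by_cases hs : s ∈ Icc t T
  · have : (s, α s, μ s) ∈ Icc 0 T ×ˢ (univ : Set X) ×ˢ simplex d :=
      ⟨⟨ht.trans hs.1, hs.2⟩, mem_univ _, hμS s hs⟩
    simp [hs.1, hs.2, piecewise, hμS s hs, ht.trans hs.1]
  · simp [hs]

theorem intervalIntegrable_of_indicator {Z : Type*} [NormedAddCommGroup Z] [MeasurableSpace Z]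
    [BorelSpace Z] [SecondCountableTopology Z] {f : ℝ → Z} {t T B : ℝ}
    (hf : Measurable ((Icc t T).indicator f)) (hB : ∀ s ∈ Icc t T, ‖f s‖ ≤ B) {p q : ℝ}
    (hp : p ∈ Icc t T) (hq : q ∈ Icc t T) : IntervalIntegrable f volume p q := by
  have hB0 : 0 ≤ B := (norm_nonneg _).trans (hB p hp)
  have h := intervalIntegrable_of_le_continuous hf (continuous_const (y := B)) (fun s => by
    by_cases hs : s ∈ Icc t T <;> simp [hs, hB0, hB s]) p q
  refine h.congr fun s hs => ?_
  have hs' : s ∈ Icc t T := (uIcc_subset_Icc hp hq) (uIoc_subset_uIcc hs)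
  exact indicator_of_mem hs' f

namespace Model

variable {d : ℕ} {A : Type*}

/-- The velocity of the law of the representative agent, as a vector: the flux from `i` to `j`
transports mass along `δ_j - δ_i`. -/
noncomputable def velocity (M : Model d A) (t : ℝ) (a : Fin d → A)
    (m : EuclideanSpace ℝ (Fin d)) : EuclideanSpace ℝ (Fin d) :=
  ∑ i, ∑ j, (m i * M.Q i j t (a i) m) •
    (EuclideanSpace.single j (1 : ℝ) - EuclideanSpace.single i 1)

theorem velocity_apply (M : Model d A) (t : ℝ) (a : Fin d → A) (m : EuclideanSpace ℝ (Fin d))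
    (k : Fin d) : M.velocity t a m k = M.drift t a m k := by
  have h1 : ∀ i j : Fin d, M.Q i j t (a i) m * m i * (EuclideanSpace.single j (1 : ℝ) k)
      = if k = j then m i * M.Q i j t (a i) m else 0 := fun i j => by
    by_cases h : k = j <;> simp [h, mul_comm]
  have h2 : ∀ i j : Fin d, M.Q i j t (a i) m * m i * (EuclideanSpace.single i (1 : ℝ) k)
      = if k = i then m i * M.Q i j t (a i) m else 0 := fun i j => by
    by_cases h : k = i <;> simp [h, mul_comm]
  have h3 : M.velocity t a m k = ∑ i, ∑ j, ((M.Q i j t (a i) m * m i *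
      (EuclideanSpace.single j (1 : ℝ) k)) - M.Q i j t (a i) m * m i *
      (EuclideanSpace.single i (1 : ℝ) k)) := by
    simp only [velocity, WithLp.ofLp_sum, Finset.sum_apply, PiLp.smul_apply, PiLp.sub_apply,
      smul_eq_mul, mul_sub, mul_comm (m.ofLp _)]
  rw [h3]
  simp only [h1, h2, Finset.sum_sub_distrib, drift, Finset.sum_ite_eq, Finset.mem_univ, if_true]
  congr 1
  rw [Finset.sum_comm]
  simp

theorem sum_velocity (M : Model d A) (t : ℝ) (a : Fin d → A) (m : EuclideanSpace ℝ (Fin d)) :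
    ∑ k, M.velocity t a m k = 0 := by
  simp only [velocity_apply, drift, Finset.sum_sub_distrib]
  rw [Finset.sum_comm, sub_self]

theorem norm_single_sub_single_le (i j : Fin d) :
    ‖(EuclideanSpace.single j (1 : ℝ) - EuclideanSpace.single i 1 : EuclideanSpace ℝ (Fin d))‖
      ≤ 2 := by
  refine (norm_sub_le _ _).trans ?_
  simp
  norm_num

/-- A single constant `K` that bounds the rates, the velocity and the costs on the simplex,
together with the Lipschitz constants in the space variable of the velocity and of the costs. -/
structure BoundedBy (M : Model d A) (K : ℝ) : Prop where
  nonneg : 0 ≤ K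
  Q_nonneg : ∀ i j, ∀ t ∈ Icc 0 M.T, ∀ a, ∀ m ∈ simplex d, 0 ≤ M.Q i j t a m
  rate_le : ∀ i, ∀ t ∈ Icc 0 M.T, ∀ a, ∀ m ∈ simplex d, ∑ j, M.Q i j t a m ≤ K
  velocity_le : ∀ t ∈ Icc 0 M.T, ∀ a, ∀ m ∈ simplex d, ‖M.velocity t a m‖ ≤ K
  velocity_lipschitz : ∀ t ∈ Icc 0 M.T, ∀ a, ∀ m ∈ simplex d, ∀ p ∈ simplex d,
    ‖M.velocity t a m - M.velocity t a p‖ ≤ K * ‖m - p‖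
  F_le : ∀ t ∈ Icc 0 M.T, ∀ a, ∀ m ∈ simplex d, |M.F t a m| ≤ K
  F_lipschitz : ∀ t ∈ Icc 0 M.T, ∀ a, ∀ m ∈ simplex d, ∀ p ∈ simplex d,
    |M.F t a m - M.F t a p| ≤ K * ‖m - p‖
  G_le : ∀ m ∈ simplex d, |M.G m| ≤ K
  G_lipschitz : ∀ m ∈ simplex d, ∀ p ∈ simplex d, |M.G m - M.G p| ≤ K * ‖m - p‖

theorem norm_velocity_sum_le {w : Fin d → Fin d → ℝ} {c : ℝ} (hw : ∀ i j, |w i j| ≤ c) :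
    ‖∑ i, ∑ j, w i j • (EuclideanSpace.single j (1 : ℝ) - EuclideanSpace.single i 1 :
      EuclideanSpace ℝ (Fin d))‖ ≤ d * (d * (c * 2)) := by
  have h : ∀ i j, ‖w i j • (EuclideanSpace.single j (1 : ℝ) - EuclideanSpace.single i 1 :
      EuclideanSpace ℝ (Fin d))‖ ≤ c * 2 := fun i j => by
    rw [norm_smul]
    exact mul_le_mul (hw i j) (norm_single_sub_single_le i j) (norm_nonneg _)
      ((abs_nonneg _).trans (hw i j))
  calc _ ≤ ∑ i : Fin d, ∑ j : Fin d, c * 2 :=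
        (norm_sum_le _ _).trans (Finset.sum_le_sum fun i _ =>
          (norm_sum_le _ _).trans (Finset.sum_le_sum fun j _ => h i j))
    _ = _ := by simp

theorem Regular.exists_boundedBy [TopologicalSpace A] [CompactSpace A] {M : Model d A}
    (hM : M.Regular) : ∃ K, M.BoundedBy K := by
  have hcp : IsCompact (Icc 0 M.T ×ˢ (univ : Set A) ×ˢ simplex d) :=
    isCompact_Icc.prod (isCompact_univ.prod (simplex_isCompact d))
  have hcp' : IsCompact (Icc 0 M.T ×ˢ (univ : Set (Fin d → A)) ×ˢ simplex d) :=
    isCompact_Icc.prod (isCompact_univ.prod (simplex_isCompact d))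
  choose q hq using fun i j => hcp.exists_bound_of_continuousOn (hM.Q_continuous i j)
  obtain ⟨B, hB⟩ := hcp'.exists_bound_of_continuousOn hM.F_continuous
  obtain ⟨l₁, hl₁⟩ := hM.Q_lipschitz
  obtain ⟨l₂, hl₂⟩ := hM.F_lipschitz
  obtain ⟨l₃, hl₃⟩ := hM.G_lipschitz
  have hGc : ContinuousOn M.G (simplex d) :=
    (LipschitzOnWith.of_dist_le' (K := l₃) fun x hx y hy => by
      simpa [dist_eq_norm] using hl₃ x hx y hy).continuousOn
  obtain ⟨B', hB'⟩ := (simplex_isCompact d).exists_bound_of_continuousOn hGc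
  set q' : ℝ := ∑ i, ∑ j, |q i j| with hq'
  have hq'0 : 0 ≤ q' := by positivity
  have hQ : ∀ i j, ∀ t ∈ Icc 0 M.T, ∀ a, ∀ m ∈ simplex d, M.Q i j t a m ≤ q' :=
    fun i j t ht a m hm => by
      have h1 : |M.Q i j t a m| ≤ q i j := hq i j (t, a, m) ⟨ht, mem_univ _, hm⟩
      have h2 : |q i j| ≤ ∑ j, |q i j| :=
        Finset.single_le_sum (f := fun j => |q i j|) (fun _ _ => abs_nonneg _) (Finset.mem_univ j)
      have h3 : ∑ j, |q i j| ≤ q' :=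
        Finset.single_le_sum (f := fun i => ∑ j, |q i j|)
          (fun _ _ => Finset.sum_nonneg fun _ _ => abs_nonneg _) (Finset.mem_univ i)
      linarith [le_abs_self (M.Q i j t a m), le_abs_self (q i j)]
  set D : ℝ := d * (d * ((q' + |l₁|) * 2)) with hD
  have hD0 : 0 ≤ D := by positivity
  have hd0 : (0 : ℝ) ≤ d * q' := by positivity
  have hlip : ∀ {l x : ℝ} {m p : EuclideanSpace ℝ (Fin d)} {t : ℝ},
      x ≤ l * (|t - t| + ‖m - p‖) → x ≤ |l| * ‖m - p‖ := fun {l x m p t} h => by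
    rw [sub_self, abs_zero, zero_add] at h
    exact h.trans (mul_le_mul_of_nonneg_right (le_abs_self l) (norm_nonneg _))
  have hK : ∀ {c : ℝ} {m p : EuclideanSpace ℝ (Fin d)} {x : ℝ},
      c ≤ d * q' + D + |B| + |B'| + |l₂| + |l₃| → x ≤ c * ‖m - p‖ →
      x ≤ (d * q' + D + |B| + |B'| + |l₂| + |l₃|) * ‖m - p‖ := fun hc hx =>
    hx.trans (mul_le_mul_of_nonneg_right hc (norm_nonneg _))
  have a1 := abs_nonneg B
  have a2 := abs_nonneg B'
  have a3 := abs_nonneg l₂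
  have a4 := abs_nonneg l₃
  refine ⟨d * q' + D + |B| + |B'| + |l₂| + |l₃|, by positivity, hM.Q_nonneg, ?_, ?_, ?_, ?_, ?_,
    ?_, ?_⟩
  · intro i t ht a m hm
    calc ∑ j, M.Q i j t a m ≤ ∑ j : Fin d, q' := Finset.sum_le_sum fun j _ => hQ i j t ht a m hm
      _ = d * q' := by simp
      _ ≤ _ := by linarith
  · intro t ht a m hm
    refine (norm_velocity_sum_le (c := q' + |l₁|) fun i j => ?_).trans
      (by linarith : D ≤ _)
    rw [abs_mul, abs_of_nonneg (hM.Q_nonneg i j t ht _ m hm)]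
    have h1 := hQ i j t ht (a i) m hm
    have h2 := mul_le_mul_of_nonneg_right (simplex_abs_le_one hm i)
      (hM.Q_nonneg i j t ht (a i) m hm)
    linarith [abs_nonneg l₁]
  · intro t ht a m hm p hp
    refine hK (c := D) (by linarith) ?_
    have e : M.velocity t a m - M.velocity t a p = ∑ i, ∑ j,
        (m i * M.Q i j t (a i) m - p i * M.Q i j t (a i) p) •
        (EuclideanSpace.single j (1 : ℝ) - EuclideanSpace.single i 1) := by
      simp only [velocity, ← Finset.sum_sub_distrib, ← sub_smul]
    rw [e]
    refine (norm_velocity_sum_le (c := (q' + |l₁|) * ‖m - p‖) fun i j => ?_).trans_eq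
      (by rw [hD]; ring)
    have h1 : |m i - p i| ≤ ‖m - p‖ := PiLp.norm_apply_le (m - p) i
    have h2 := hlip (hl₁ i j t ht t ht (a i) m hm p hp)
    have h3 := hQ i j t ht (a i) m hm
    have h4 := hM.Q_nonneg i j t ht (a i) m hm
    have h5 := simplex_abs_le_one hp i
    have h6 : m i * M.Q i j t (a i) m - p i * M.Q i j t (a i) p
        = (m i - p i) * M.Q i j t (a i) m + p i * (M.Q i j t (a i) m - M.Q i j t (a i) p) := by
      ring
    rw [h6]
    refine (abs_add_le _ _).trans ?_
    rw [abs_mul, abs_mul, abs_of_nonneg h4, add_mul, mul_comm q']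
    refine add_le_add (mul_le_mul h1 h3 h4 (norm_nonneg _)) ?_
    calc _ ≤ 1 * (|l₁| * ‖m - p‖) := mul_le_mul h5 h2 (abs_nonneg _) zero_le_one
      _ = _ := one_mul _
  · intro t ht a m hm
    have := hB (t, a, m) ⟨ht, mem_univ _, hm⟩
    rw [Real.norm_eq_abs] at this
    change |M.F t a m| ≤ B at this
    linarith [le_abs_self B]
  · intro t ht a m hm p hp
    exact hK (c := |l₂|) (by linarith) (hlip (hl₂ t ht t ht a m hm p hp))
  · intro m hm
    have : |M.G m| ≤ B' := hB' m hm
    linarith [le_abs_self B']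
  · intro m hm p hp
    exact hK (c := |l₃|) (by linarith) ((hl₃ m hm p hp).trans
      (mul_le_mul_of_nonneg_right (le_abs_self _) (norm_nonneg _)))

theorem Regular.velocity_continuousOn [TopologicalSpace A] {M : Model d A} (hM : M.Regular) :
    ContinuousOn (fun z : ℝ × (Fin d → A) × EuclideanSpace ℝ (Fin d) =>
      M.velocity z.1 z.2.1 z.2.2) (Icc 0 M.T ×ˢ univ ×ˢ simplex d) := by
  refine continuousOn_finsetSum _ fun i _ => continuousOn_finsetSum _ fun j _ => ?_
  have h : Continuous fun z : ℝ × (Fin d → A) × EuclideanSpace ℝ (Fin d) => z.2.2 i := by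
    fun_prop
  refine ContinuousOn.smul (h.continuousOn.mul ?_) continuousOn_const
  exact (hM.Q_continuous i j).comp (f := fun z : ℝ × (Fin d → A) × EuclideanSpace ℝ (Fin d) =>
    (z.1, z.2.1 i, z.2.2)) (by fun_prop) fun z hz => ⟨hz.1, mem_univ _, hz.2.2⟩

theorem IsTrajectory.left_eq {M : Model d A} {α : ℝ → Fin d → A} {t : ℝ}
    {m : EuclideanSpace ℝ (Fin d)}
    {μ : ℝ → EuclideanSpace ℝ (Fin d)} (h : M.IsTrajectory α t m μ) (ht : t ≤ M.T) : μ t = m := by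
  ext i
  simpa using h.integral_eq t (left_mem_Icc.2 ht) i

/-- The Euler step of size `1 / (K + 1)` preserves the simplex, as the outflow from `i` is at most
`K m_i`. -/
theorem add_smul_velocity_mem {M : Model d A} {K : ℝ} (hK : M.BoundedBy K) {t : ℝ}
    (ht : t ∈ Icc 0 M.T) (a : Fin d → A)
    {m : EuclideanSpace ℝ (Fin d)} (hm : m ∈ simplex d) :
    m + (K + 1)⁻¹ • M.velocity t a m ∈ simplex d := by
  have hK0 := hK.nonneg
  refine ⟨fun i => ?_, ?_⟩
  · rw [PiLp.add_apply, PiLp.smul_apply, velocity_apply, drift, Finset.sum_sub_distrib,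
      ← Finset.mul_sum, smul_eq_mul]
    have h1 : 0 ≤ ∑ j, m j * M.Q j i t (a j) m := Finset.sum_nonneg fun j _ =>
      mul_nonneg (hm.1 j) (hK.Q_nonneg j i t ht _ m hm)
    have h2 := mul_le_mul_of_nonneg_left (hK.rate_le i t ht (a i) m hm) (hm.1 i)
    have h3 : m i = (K + 1)⁻¹ * (m i * (K + 1)) := by field_simp
    have h4 : 0 ≤ (K + 1)⁻¹ := by positivity
    have h5 := hm.1 i
    nlinarith [mul_nonneg h4 (by linarith : 0 ≤ m i * (K + 1) + (∑ j, m j * M.Q j i t (a j) m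
      - m i * ∑ j, M.Q i j t (a i) m))]
  · simp only [PiLp.add_apply, PiLp.smul_apply, Finset.sum_add_distrib, ← Finset.smul_sum,
      sum_velocity, smul_zero, add_zero, hm.2]

section Trajectories

variable [MetricSpace A] [CompactSpace A] [MeasurableSpace A] [BorelSpace A] {M : Model d A}
  {K : ℝ}

theorem Regular.velocity_intervalIntegrable (hM : M.Regular) (hK : M.BoundedBy K) {t : ℝ}
    (ht : 0 ≤ t) {α : ℝ → Fin d → A} (hα : Measurable α) {μ : ℝ → EuclideanSpace ℝ (Fin d)}
    (hμ : ContinuousOn μ (Icc t M.T)) (hμS : ∀ s ∈ Icc t M.T, μ s ∈ simplex d) {p q : ℝ}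
    (hp : p ∈ Icc t M.T) (hq : q ∈ Icc t M.T) :
    IntervalIntegrable (fun s => M.velocity s (α s) (μ s)) volume p q :=
  intervalIntegrable_of_indicator
    (measurable_indicator_along hM.velocity_continuousOn ht hα hμ hμS)
    (fun s hs => hK.velocity_le s ⟨ht.trans hs.1, hs.2⟩ _ _ (hμS s hs)) hp hq

theorem Regular.F_intervalIntegrable (hM : M.Regular) (hK : M.BoundedBy K) {t : ℝ}
    (ht : 0 ≤ t) {α : ℝ → Fin d → A} (hα : Measurable α) {μ : ℝ → EuclideanSpace ℝ (Fin d)}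
    (hμ : ContinuousOn μ (Icc t M.T)) (hμS : ∀ s ∈ Icc t M.T, μ s ∈ simplex d) {p q : ℝ}
    (hp : p ∈ Icc t M.T) (hq : q ∈ Icc t M.T) :
    IntervalIntegrable (fun s => M.F s (α s) (μ s)) volume p q :=
  intervalIntegrable_of_indicator
    (measurable_indicator_along hM.F_continuous ht hα hμ hμS)
    (fun s hs => hK.F_le s ⟨ht.trans hs.1, hs.2⟩ _ _ (hμS s hs)) hp hq

/-- The trajectory equation, as an equation between vectors. -/
theorem isTrajectory_iff (hM : M.Regular) (hK : M.BoundedBy K) {t : ℝ}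
    (ht : 0 ≤ t) {α : ℝ → Fin d → A} (hα : Measurable α) {m : EuclideanSpace ℝ (Fin d)}
    {μ : ℝ → EuclideanSpace ℝ (Fin d)} :
    M.IsTrajectory α t m μ ↔ ContinuousOn μ (Icc t M.T) ∧ (∀ s ∈ Icc t M.T, μ s ∈ simplex d) ∧
      ∀ s ∈ Icc t M.T, μ s = m + ∫ r in t..s, M.velocity r (α r) (μ r) := by
  have key : ContinuousOn μ (Icc t M.T) → (∀ s ∈ Icc t M.T, μ s ∈ simplex d) →
      ∀ s ∈ Icc t M.T, ∀ i, (m + ∫ r in t..s, M.velocity r (α r) (μ r)) i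
        = m i + ∫ r in t..s, M.drift r (α r) (μ r) i := fun h1 h2 s hs i => by
    have h := (EuclideanSpace.proj (𝕜 := ℝ) i).intervalIntegral_comp_comm
      (hM.velocity_intervalIntegrable hK ht hα h1 h2 (left_mem_Icc.2 (hs.1.trans hs.2)) hs)
    rw [PiLp.add_apply]
    congr 1
    rw [show (∫ r in t..s, M.velocity r (α r) (μ r)) i
      = EuclideanSpace.proj (𝕜 := ℝ) i (∫ r in t..s, M.velocity r (α r) (μ r)) from rfl, ← h]
    refine intervalIntegral.integral_congr fun r _ => ?_
    exact M.velocity_apply r (α r) (μ r) i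
  refine ⟨fun h => ⟨h.continuous, h.mem_simplex, fun s hs => ?_⟩, fun h => ⟨h.1, h.2.1, ?_⟩⟩
  · ext i
    rw [key h.continuous h.mem_simplex s hs, h.integral_eq s hs]
  · intro s hs i
    rw [← key h.1 h.2.1 s hs, ← h.2.2 s hs]

theorem exists_isTrajectory (hM : M.Regular) (hK : M.BoundedBy K) {t : ℝ} (ht : t ∈ Icc 0 M.T)
    {α : ℝ → Fin d → A} (hα : Measurable α) {m : EuclideanSpace ℝ (Fin d)} (hm : m ∈ simplex d) :
    ∃ μ, M.IsTrajectory α t m μ := by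
  obtain ⟨μ, h1, h2, h3⟩ := exists_solution_in_convex (simplex_isCompact d).isClosed
    (simplex_convex d) (g := fun r x => (Icc 0 M.T).indicator (fun r => M.velocity r (α r) x) r)
    (fun x hx => measurable_indicator_along hM.velocity_continuousOn le_rfl hα continuousOn_const
      fun _ _ => hx)
    (L := K) (B := K) (lam := K + 1) hK.nonneg (fun r x hx y hy => by
      by_cases hr : r ∈ Icc 0 M.T
      · simpa only [indicator_of_mem hr] using hK.velocity_lipschitz r hr _ x hx y hy
      · simpa only [indicator_of_notMem hr, sub_zero, norm_zero] using
          mul_nonneg hK.nonneg (norm_nonneg _))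
    (fun r x hx => by
      by_cases hr : r ∈ Icc 0 M.T
      · simpa only [indicator_of_mem hr] using hK.velocity_le r hr _ x hx
      · simpa only [indicator_of_notMem hr, norm_zero] using hK.nonneg)
    (by linarith [hK.nonneg]) (fun r x hx => by
      by_cases hr : r ∈ Icc 0 M.T
      · simpa only [indicator_of_mem hr] using add_smul_velocity_mem hK hr _ hx
      · simpa only [indicator_of_notMem hr, smul_zero, add_zero] using hx)
    ht.2 hm
  refine ⟨μ, (isTrajectory_iff hM hK ht.1 hα).2 ⟨h1.continuousOn, h2, fun s hs => ?_⟩⟩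
  rw [h3 s hs]
  congr 1
  refine intervalIntegral.integral_congr fun r hr => ?_
  rw [uIcc_of_le hs.1] at hr
  have hr' : r ∈ Icc 0 M.T := ⟨ht.1.trans hr.1, hr.2.trans hs.2⟩
  simp only [indicator_of_mem hr']

end Trajectories
end Model

/-! ### The mean field value function -/

namespace Model

variable {d : ℕ} {A : Type*}

theorem integral_F_le {M : Model d A} {K : ℝ} (hK : M.BoundedBy K) {α : ℝ → Fin d → A}
    {μ : ℝ → EuclideanSpace ℝ (Fin d)} {t s : ℝ} (ht : 0 ≤ t) (hts : t ≤ s) (hs : s ≤ M.T)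
    (h : ∀ r ∈ Icc t s, μ r ∈ simplex d) :
    |∫ r in t..s, M.F r (α r) (μ r)| ≤ K * (s - t) := by
  have := intervalIntegral.norm_integral_le_of_norm_le_const (a := t) (b := s) (C := K)
    (f := fun r => M.F r (α r) (μ r)) fun r hr => by
      rw [uIoc_of_le hts] at hr
      exact hK.F_le r ⟨ht.trans hr.1.le, hr.2.trans hs⟩ _ _
        (h r ⟨hr.1.le, hr.2⟩)
  rwa [abs_of_nonneg (sub_nonneg.2 hts)] at this

theorem IsTrajectory.abs_cost_le {M : Model d A} {K : ℝ} (hK : M.BoundedBy K) {t : ℝ}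
    (ht : t ∈ Icc 0 M.T)
    {α : ℝ → Fin d → A} {m : EuclideanSpace ℝ (Fin d)}
    {μ : ℝ → EuclideanSpace ℝ (Fin d)} (h : M.IsTrajectory α t m μ) :
    |M.cost α μ t| ≤ K * (M.T + 1) := by
  have h1 := integral_F_le hK (α := α) ht.1 ht.2 le_rfl h.mem_simplex
  have h2 := hK.G_le _ (h.mem_simplex M.T (right_mem_Icc.2 ht.2))
  have h3 := mul_le_mul_of_nonneg_left (by linarith [ht.1] : M.T - t ≤ M.T) hK.nonneg
  exact (abs_add_le _ _).trans (by linarith)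

theorem value_le_cost [MeasurableSpace A] {M : Model d A} {K : ℝ} (hK : M.BoundedBy K) {t : ℝ}
    (ht : t ∈ Icc 0 M.T)
    {α : ℝ → Fin d → A} (hα : Measurable α) {m : EuclideanSpace ℝ (Fin d)}
    {μ : ℝ → EuclideanSpace ℝ (Fin d)} (h : M.IsTrajectory α t m μ) :
    M.value t m ≤ M.cost α μ t := by
  refine csInf_le ⟨-(K * (M.T + 1)), ?_⟩ ⟨α, μ, hα, h, rfl⟩
  rintro _ ⟨α', μ', -, h', rfl⟩
  exact (abs_le.1 (h'.abs_cost_le hK ht)).1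

section Value

variable [MetricSpace A] [CompactSpace A] [MeasurableSpace A] [BorelSpace A] {M : Model d A}
  {K : ℝ}

theorem IsTrajectory.norm_sub_le (hM : M.Regular) (hK : M.BoundedBy K) {t : ℝ} (ht : 0 ≤ t)
    {α : ℝ → Fin d → A} (hα : Measurable α) {m : EuclideanSpace ℝ (Fin d)}
    {μ : ℝ → EuclideanSpace ℝ (Fin d)} (h : M.IsTrajectory α t m μ) {s : ℝ} (hs : s ∈ Icc t M.T) :
    ‖μ s - m‖ ≤ K * (s - t) := by
  rw [((isTrajectory_iff hM hK ht hα).1 h).2.2 s hs, add_sub_cancel_left]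
  have := intervalIntegral.norm_integral_le_of_norm_le_const (a := t) (b := s) (C := K)
    (f := fun r => M.velocity r (α r) (μ r)) fun r hr => by
      rw [uIoc_of_le hs.1] at hr
      exact hK.velocity_le r ⟨ht.trans hr.1.le, hr.2.trans hs.2⟩ _ _
        (h.mem_simplex r ⟨hr.1.le, hr.2.trans hs.2⟩)
  rwa [abs_of_nonneg (sub_nonneg.2 hs.1)] at this

theorem IsTrajectory.restrict (hM : M.Regular) (hK : M.BoundedBy K) {t : ℝ} (ht : 0 ≤ t)
    {α : ℝ → Fin d → A} (hα : Measurable α) {m : EuclideanSpace ℝ (Fin d)}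
    {μ : ℝ → EuclideanSpace ℝ (Fin d)} (h : M.IsTrajectory α t m μ) {s : ℝ} (hs : s ∈ Icc t M.T) :
    M.IsTrajectory α s (μ s) μ := by
  have h' := ((isTrajectory_iff hM hK ht hα).1 h)
  have hsub : Icc s M.T ⊆ Icc t M.T := Icc_subset_Icc_left hs.1
  refine (isTrajectory_iff hM hK (ht.trans hs.1) hα).2
    ⟨h'.1.mono hsub, fun r hr => h'.2.1 r (hsub hr), fun r hr => ?_⟩
  have hl : t ∈ Icc t M.T := left_mem_Icc.2 (hs.1.trans hs.2)
  rw [h'.2.2 r (hsub hr), h'.2.2 s hs, add_assoc, intervalIntegral.integral_add_adjacent_intervals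
    (hM.velocity_intervalIntegrable hK ht hα h'.1 h'.2.1 hl hs)
    (hM.velocity_intervalIntegrable hK ht hα h'.1 h'.2.1 hs (hsub hr))]

theorem IsTrajectory.cost_eq (hM : M.Regular) (hK : M.BoundedBy K) {t : ℝ} (ht : 0 ≤ t)
    {α : ℝ → Fin d → A} (hα : Measurable α) {m : EuclideanSpace ℝ (Fin d)}
    {μ : ℝ → EuclideanSpace ℝ (Fin d)} (h : M.IsTrajectory α t m μ) {s : ℝ} (hs : s ∈ Icc t M.T) :
    M.cost α μ t = (∫ r in t..s, M.F r (α r) (μ r)) + M.cost α μ s := by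
  have hT : t ≤ M.T := hs.1.trans hs.2
  rw [cost, cost, ← add_assoc, intervalIntegral.integral_add_adjacent_intervals
    (hM.F_intervalIntegrable hK ht hα h.continuous h.mem_simplex (left_mem_Icc.2 hT) hs)
    (hM.F_intervalIntegrable hK ht hα h.continuous h.mem_simplex hs (right_mem_Icc.2 hT))]

theorem le_value [Nonempty A] (hM : M.Regular) (hK : M.BoundedBy K) {t : ℝ} (ht : t ∈ Icc 0 M.T)
    {m : EuclideanSpace ℝ (Fin d)} (hm : m ∈ simplex d) {c : ℝ}
    (hc : ∀ α μ, Measurable α → M.IsTrajectory α t m μ → c ≤ M.cost α μ t) :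
    c ≤ M.value t m := by
  refine le_csInf ?_ ?_
  · have hα : Measurable (fun (_ : ℝ) (_ : Fin d) => Classical.arbitrary A) := measurable_const
    obtain ⟨μ, hμ⟩ := exists_isTrajectory hM hK ht hα hm
    exact ⟨_, _, μ, hα, hμ, rfl⟩
  · rintro _ ⟨α, μ, hα, h, rfl⟩
    exact hc α μ hα h

/-- A trajectory up to time `s`, continued by another one from its end point, is a trajectory for
the concatenated controls, and the costs add up. -/
theorem IsTrajectory.concat (hM : M.Regular) (hK : M.BoundedBy K) {t : ℝ} (ht : 0 ≤ t)
    {α β : ℝ → Fin d → A} (hα : Measurable α) (hβ : Measurable β) {m : EuclideanSpace ℝ (Fin d)}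
    {μ ν : ℝ → EuclideanSpace ℝ (Fin d)} (h : M.IsTrajectory α t m μ) {s : ℝ}
    (hs : s ∈ Icc t M.T) (h' : M.IsTrajectory β s (μ s) ν) :
    M.IsTrajectory ((Iic s).piecewise α β) t m ((Iic s).piecewise μ ν) ∧
      M.cost ((Iic s).piecewise α β) ((Iic s).piecewise μ ν) t
        = (∫ r in t..s, M.F r (α r) (μ r)) + M.cost β ν s := by
  have hγ : Measurable ((Iic s).piecewise α β) := hα.piecewise measurableSet_Iic hβ
  have hμs : ν s = μ s := h'.left_eq hs.2
  have hle : ∀ {Z : Type _} (x y : ℝ → Z), ∀ r ≤ s, (Iic s).piecewise x y r = x r :=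
    fun x y r hr => piecewise_eq_of_mem _ _ _ hr
  have hlt : ∀ {Z : Type _} (x y : ℝ → Z), ∀ r, s < r → (Iic s).piecewise x y r = y r :=
    fun x y r hr => piecewise_eq_of_notMem _ _ _ (not_le.2 hr)
  have hge : ∀ r, s ≤ r → (Iic s).piecewise μ ν r = ν r := fun r hr => by
    rcases hr.eq_or_lt with rfl | hr
    · rw [hle _ _ _ le_rfl, hμs]
    · exact hlt _ _ _ hr
  have e := (isTrajectory_iff hM hK ht hα).1 h
  have e' := (isTrajectory_iff hM hK (ht.trans hs.1) hβ).1 h'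
  have hcont : ContinuousOn ((Iic s).piecewise μ ν) (Icc t M.T) := by
    rw [← Icc_union_Icc_eq_Icc hs.1 hs.2]
    refine ContinuousOn.union_of_isClosed ?_ ?_ isClosed_Icc isClosed_Icc
    · exact (e.1.mono (Icc_subset_Icc_right hs.2)).congr fun r hr => hle _ _ r hr.2
    · exact e'.1.congr fun r hr => hge r hr.1
  have hmem : ∀ r ∈ Icc t M.T, (Iic s).piecewise μ ν r ∈ simplex d := fun r hr => by
    rcases le_total r s with hrs | hrs
    · rw [hle _ _ r hrs]; exact e.2.1 r hr
    · rw [hge r hrs]; exact e'.2.1 r ⟨hrs, hr.2⟩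
  have hT : t ∈ Icc t M.T := left_mem_Icc.2 (hs.1.trans hs.2)
  have hint1 : ∀ {Z : Type} [NormedAddCommGroup Z] [NormedSpace ℝ Z]
      (φ : ℝ → (Fin d → A) → EuclideanSpace ℝ (Fin d) → Z) (r : ℝ), t ≤ r → r ≤ s →
      ∫ q in t..r, φ q ((Iic s).piecewise α β q) ((Iic s).piecewise μ ν q)
        = ∫ q in t..r, φ q (α q) (μ q) := fun φ r hr hr' => by
    refine intervalIntegral.integral_congr fun q hq => ?_
    rw [uIcc_of_le hr] at hq
    rw [piecewise_eq_of_mem (Iic s) α β (mem_Iic.2 (hq.2.trans hr')), hle _ _ q (hq.2.trans hr')]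
  have hint2 : ∀ {Z : Type} [NormedAddCommGroup Z] [NormedSpace ℝ Z]
      (φ : ℝ → (Fin d → A) → EuclideanSpace ℝ (Fin d) → Z) (r : ℝ), s ≤ r →
      ∫ q in s..r, φ q ((Iic s).piecewise α β q) ((Iic s).piecewise μ ν q)
        = ∫ q in s..r, φ q (β q) (ν q) := fun φ r hr => by
    refine intervalIntegral.integral_congr_ae (Filter.Eventually.of_forall fun q hq => ?_)
    rw [uIoc_of_le hr] at hq
    rw [piecewise_eq_of_notMem (Iic s) α β (notMem_Iic.2 hq.1), hlt _ _ q hq.1]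
  have htraj : M.IsTrajectory ((Iic s).piecewise α β) t m ((Iic s).piecewise μ ν) := by
    refine (isTrajectory_iff hM hK ht hγ).2 ⟨hcont, hmem, fun r hr => ?_⟩
    rcases le_total r s with hrs | hrs
    · rw [hle _ _ r hrs, hint1 _ r hr.1 hrs]
      exact e.2.2 r hr
    · rw [← intervalIntegral.integral_add_adjacent_intervals
        (hM.velocity_intervalIntegrable hK ht hγ hcont hmem hT hs)
        (hM.velocity_intervalIntegrable hK ht hγ hcont hmem hs hr), hint1 _ s hs.1 le_rfl,
        hint2 _ r hrs, hge r hrs, ← add_assoc, ← e.2.2 s hs]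
      exact e'.2.2 r ⟨hrs, hr.2⟩
  refine ⟨htraj, ?_⟩
  rw [htraj.cost_eq hM hK ht hγ hs, hint1 _ s hs.1 le_rfl, cost, hint2 _ _ hs.2, hge _ hs.2, cost]

/-- The dynamic programming inequality for the mean field problem. -/
theorem value_le_integral_add_value [Nonempty A] (hM : M.Regular) (hK : M.BoundedBy K) {t : ℝ}
    (ht : 0 ≤ t) {α : ℝ → Fin d → A} (hα : Measurable α) {m : EuclideanSpace ℝ (Fin d)}
    {μ : ℝ → EuclideanSpace ℝ (Fin d)} (h : M.IsTrajectory α t m μ) {s : ℝ}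
    (hs : s ∈ Icc t M.T) :
    M.value t m ≤ (∫ r in t..s, M.F r (α r) (μ r)) + M.value s (μ s) := by
  rw [← sub_le_iff_le_add']
  refine le_value hM hK ⟨ht.trans hs.1, hs.2⟩ (h.mem_simplex s hs) fun β ν hβ hν => ?_
  obtain ⟨h1, h2⟩ := h.concat hM hK ht hα hβ hs hν
  rw [sub_le_iff_le_add', ← h2]
  exact value_le_cost hK ⟨ht, hs.1.trans hs.2⟩ (hα.piecewise measurableSet_Iic hβ) h1

theorem IsTrajectory.norm_sub_le_exp (hM : M.Regular) (hK : M.BoundedBy K) {t : ℝ} (ht : 0 ≤ t)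
    {α : ℝ → Fin d → A} (hα : Measurable α) {m p : EuclideanSpace ℝ (Fin d)}
    {μ ν : ℝ → EuclideanSpace ℝ (Fin d)} (h : M.IsTrajectory α t m μ)
    (h' : M.IsTrajectory α t p ν) {s : ℝ} (hs : s ∈ Icc t M.T) :
    ‖μ s - ν s‖ ≤ ‖m - p‖ * Real.exp (K * M.T) := by
  have hT := hs.1.trans hs.2
  have e := (isTrajectory_iff hM hK ht hα).1 h
  have e' := (isTrajectory_iff hM hK ht hα).1 h'
  have h1 := norm_sub_le_of_integral_equation (g := fun r => M.velocity r (α r)) (K := simplex d)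
    hK.nonneg (fun r hr => hK.velocity_lipschitz r ⟨ht.trans hr.1, hr.2⟩ (α r)) e.1 e'.1 e.2.1
    e'.2.1
    (hM.velocity_intervalIntegrable hK ht hα e.1 e.2.1 (left_mem_Icc.2 hT) (right_mem_Icc.2 hT))
    (hM.velocity_intervalIntegrable hK ht hα e'.1 e'.2.1 (left_mem_Icc.2 hT) (right_mem_Icc.2 hT))
    (fun r hr => by rw [h.left_eq hT]; exact e.2.2 r hr)
    (fun r hr => by rw [h'.left_eq hT]; exact e'.2.2 r hr) s hs
  rw [h.left_eq hT, h'.left_eq hT] at h1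
  refine h1.trans ?_
  have := hK.nonneg
  gcongr
  linarith [hs.2]

/-- The mean field value function is Lipschitz in space: the same control is used from both
points. -/
theorem value_le_add_mul_norm [Nonempty A] (hM : M.Regular) (hK : M.BoundedBy K) {t : ℝ}
    (ht : t ∈ Icc 0 M.T) {m p : EuclideanSpace ℝ (Fin d)} (hm : m ∈ simplex d)
    (hp : p ∈ simplex d) :
    M.value t m ≤ M.value t p + K * (M.T + 1) * Real.exp (K * M.T) * ‖m - p‖ := by
  rw [← sub_le_iff_le_add]
  refine le_value hM hK ht hp fun α ν hα hν => ?_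
  rw [sub_le_iff_le_add]
  obtain ⟨μ, hμ⟩ := exists_isTrajectory hM hK ht hα hm
  refine (value_le_cost hK ht hα hμ).trans ?_
  set D := ‖m - p‖ * Real.exp (K * M.T) with hD
  have hdist : ∀ r ∈ Icc t M.T, ‖μ r - ν r‖ ≤ D := fun r hr =>
    hμ.norm_sub_le_exp hM hK ht.1 hα hν hr
  have hr := right_mem_Icc.2 ht.2
  have hl := left_mem_Icc.2 ht.2
  have h1 := (le_abs_self _).trans
    (hK.G_lipschitz _ (hμ.mem_simplex _ hr) _ (hν.mem_simplex _ hr))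
  have h2 := mul_le_mul_of_nonneg_left (hdist _ hr) hK.nonneg
  have h3 := intervalIntegral.norm_integral_le_of_norm_le_const (a := t) (b := M.T) (C := K * D)
    (f := fun r => M.F r (α r) (μ r) - M.F r (α r) (ν r)) fun r hr => by
      rw [uIoc_of_le ht.2] at hr
      have hr' : r ∈ Icc t M.T := ⟨hr.1.le, hr.2⟩
      exact (hK.F_lipschitz r ⟨ht.1.trans hr.1.le, hr.2⟩ _ _ (hμ.mem_simplex r hr') _
        (hν.mem_simplex r hr')).trans (mul_le_mul_of_nonneg_left (hdist r hr') hK.nonneg)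
  rw [intervalIntegral.integral_sub
    (hM.F_intervalIntegrable hK ht.1 hα hμ.continuous hμ.mem_simplex hl hr)
    (hM.F_intervalIntegrable hK ht.1 hα hν.continuous hν.mem_simplex hl hr),
    abs_of_nonneg (sub_nonneg.2 ht.2)] at h3
  have h4 := (Real.le_norm_self _).trans h3
  have hKD : 0 ≤ K * D := mul_nonneg hK.nonneg (by positivity)
  have h5 := mul_le_mul_of_nonneg_left (by linarith [ht.1] : M.T - t ≤ M.T) hKD
  have h6 : K * (M.T + 1) * Real.exp (K * M.T) * ‖m - p‖ = K * D * M.T + K * D := by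
    rw [hD]; ring
  rw [h6, cost, cost]
  linarith

/-- The mean field value function is Lipschitz in time: a trajectory moves by at most `K (s - t)`,
and the value function is Lipschitz in space. -/
theorem abs_value_sub_value_le [Nonempty A] (hM : M.Regular) (hK : M.BoundedBy K) {t s : ℝ}
    (ht : 0 ≤ t) (hts : t ≤ s) (hs : s ≤ M.T) {m : EuclideanSpace ℝ (Fin d)}
    (hm : m ∈ simplex d) :
    |M.value t m - M.value s m| ≤
      (K + K * (M.T + 1) * Real.exp (K * M.T) * K) * (s - t) := by
  set L := K * (M.T + 1) * Real.exp (K * M.T) with hL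
  have hT0 : 0 ≤ M.T := ht.trans (hts.trans hs)
  have hL0 : 0 ≤ L := by have := hK.nonneg; positivity
  have htI : t ∈ Icc 0 M.T := ⟨ht, hts.trans hs⟩
  have hsI : s ∈ Icc 0 M.T := ⟨ht.trans hts, hs⟩
  have hsI' : s ∈ Icc t M.T := ⟨hts, hs⟩
  rw [abs_sub_le_iff]
  constructor
  · have hα : Measurable (fun (_ : ℝ) (_ : Fin d) => Classical.arbitrary A) := measurable_const
    obtain ⟨μ, hμ⟩ := exists_isTrajectory hM hK htI hα hm
    have h1 := value_le_integral_add_value hM hK ht hα hμ hsI'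
    have h2 := (abs_le.1 (integral_F_le hK (α := fun (_ : ℝ) (_ : Fin d) => Classical.arbitrary A)
      ht hts hs fun r hr => hμ.mem_simplex r ⟨hr.1, hr.2.trans hs⟩)).2
    have h3 := value_le_add_mul_norm hM hK hsI (hμ.mem_simplex s hsI') hm
    have h4 := mul_le_mul_of_nonneg_left (hμ.norm_sub_le hM hK ht hα hsI') hL0
    linarith
  · rw [sub_le_comm]
    refine le_value hM hK htI hm fun α μ hα hμ => ?_
    rw [hμ.cost_eq hM hK ht hα hsI']
    have h1 := value_le_cost hK hsI hα (hμ.restrict hM hK ht hα hsI')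
    have h2 := (abs_le.1 (integral_F_le hK (α := α) (μ := μ)
      ht hts hs fun r hr => hμ.mem_simplex r ⟨hr.1, hr.2.trans hs⟩)).1
    have h3 := value_le_add_mul_norm hM hK hsI hm (hμ.mem_simplex s hsI')
    have h4 := mul_le_mul_of_nonneg_left (hμ.norm_sub_le hM hK ht hα hsI') hL0
    rw [norm_sub_rev] at h4
    linarith

end Value
end Model

/-! ### Finite Markov chains with rates measurable in time -/

section FiniteChain

variable {ι : Type*} [Fintype ι] [DecidableEq ι]

theorem sum_smul_single (p : EuclideanSpace ℝ ι) :
    ∑ z, p z • EuclideanSpace.single z (1 : ℝ) = p := by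
  ext k
  simp only [WithLp.ofLp_sum, Finset.sum_apply, PiLp.smul_apply, smul_eq_mul,
    PiLp.single_apply, mul_ite, mul_one, mul_zero]
  simp

/-- The field `p ↦ p ρ` (row vector times rate matrix) of the forward equation. -/
noncomputable def forwardField (ρ : ι → ι → ℝ) (p : EuclideanSpace ℝ ι) : EuclideanSpace ℝ ι :=
  ∑ x, ∑ y, (p x * ρ x y) • EuclideanSpace.single y (1 : ℝ)

theorem forwardField_apply (ρ : ι → ι → ℝ) (p : EuclideanSpace ℝ ι) (y : ι) :
    forwardField ρ p y = ∑ x, p x * ρ x y := by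
  simp only [forwardField, WithLp.ofLp_sum, Finset.sum_apply, PiLp.smul_apply, smul_eq_mul,
    PiLp.single_apply, mul_ite, mul_one, mul_zero]
  simp

theorem forwardField_sub (ρ : ι → ι → ℝ) (p q : EuclideanSpace ℝ ι) :
    forwardField ρ p - forwardField ρ q = forwardField ρ (p - q) := by
  ext y
  simp only [PiLp.sub_apply, forwardField_apply, ← Finset.sum_sub_distrib, sub_mul]

theorem norm_forwardField_le {ρ : ι → ι → ℝ} {c k : ℝ} (hρ : ∀ x y, |ρ x y| ≤ c) (hk : 0 ≤ k)
    {p : EuclideanSpace ℝ ι} (hp : ∀ x, |p x| ≤ k) :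
    ‖forwardField ρ p‖ ≤ Fintype.card ι * (Fintype.card ι * c) * k := by
  calc _ ≤ ∑ x : ι, ∑ y : ι, k * c :=
        (norm_sum_le _ _).trans (Finset.sum_le_sum fun x _ =>
          (norm_sum_le _ _).trans (Finset.sum_le_sum fun y _ => by
            rw [norm_smul, PiLp.norm_single, norm_one, mul_one, Real.norm_eq_abs, abs_mul]
            exact mul_le_mul (hp x) (hρ x y) (abs_nonneg _) hk))
    _ = _ := by simp; ring

theorem norm_forwardField_sub_le {ρ : ι → ι → ℝ} {c : ℝ} (hρ : ∀ x y, |ρ x y| ≤ c)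
    (p q : EuclideanSpace ℝ ι) : ‖forwardField ρ p - forwardField ρ q‖
      ≤ Fintype.card ι * (Fintype.card ι * c) * ‖p - q‖ := by
  rw [forwardField_sub]
  exact norm_forwardField_le hρ (norm_nonneg _) fun x => PiLp.norm_apply_le (p - q) x

/-- The Euler step of the forward equation of size `1 / (c + 1)` preserves probability vectors. -/
theorem add_smul_forwardField_mem {ρ : ι → ι → ℝ} {c : ℝ} (hc : 0 ≤ c)
    (hρ : ∀ x y, |ρ x y| ≤ c) (hnn : ∀ x y, x ≠ y → 0 ≤ ρ x y) (hsum : ∀ x, ∑ y, ρ x y = 0)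
    {p : EuclideanSpace ℝ ι} (hp : p ∈ probVectors ι) :
    p + (c + 1)⁻¹ • forwardField ρ p ∈ probVectors ι := by
  refine ⟨fun y => ?_, ?_⟩
  · rw [PiLp.add_apply, PiLp.smul_apply, forwardField_apply, smul_eq_mul,
      ← Finset.add_sum_erase _ _ (Finset.mem_univ y)]
    have h1 : 0 ≤ ∑ x ∈ Finset.univ.erase y, p x * ρ x y := Finset.sum_nonneg fun x hx =>
      mul_nonneg (hp.1 x) (hnn x y (Finset.ne_of_mem_erase hx))
    have h2 := mul_le_mul_of_nonneg_left (abs_le.1 (hρ y y)).1 (hp.1 y)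
    have h3 : p y = (c + 1)⁻¹ * (p y * (c + 1)) := by field_simp
    have h4 : 0 ≤ (c + 1)⁻¹ := by positivity
    have h5 := hp.1 y
    nlinarith [mul_nonneg h4 (by linarith : 0 ≤ p y * (c + 1) + (p y * ρ y y
      + ∑ x ∈ Finset.univ.erase y, p x * ρ x y))]
  · simp only [PiLp.add_apply, PiLp.smul_apply, Finset.sum_add_distrib, ← Finset.smul_sum,
      forwardField_apply, hp.2]
    rw [Finset.sum_comm]
    simp [← Finset.mul_sum, hsum]

/-- Existence of the transition function of a time-inhomogeneous finite Markov chain with bounded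
rates that are only measurable in time. -/
theorem exists_transitionMatrix {ρ : ℝ → ι → ι → ℝ} {c : ℝ} (hc : 0 ≤ c)
    (hmeas : ∀ x y, Measurable fun r => ρ r x y) (hρ : ∀ r x y, |ρ r x y| ≤ c)
    (hnn : ∀ r x y, x ≠ y → 0 ≤ ρ r x y) (hsum : ∀ r x, ∑ y, ρ r x y = 0) (T : ℝ) :
    ∃ P : ℝ → ℝ → Matrix ι ι ℝ,
      (∀ s r, s ≤ r → r ≤ T → ∀ x y, 0 ≤ P s r x y) ∧
      (∀ s r, s ≤ r → r ≤ T → ∀ x, ∑ y, P s r x y = 1) ∧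
      (∀ s ≤ T, P s s = 1) ∧
      (∀ s u r, s ≤ u → u ≤ r → r ≤ T → P s r = P s u * P u r) ∧
      (∀ s ≤ T, ∀ x y, Continuous fun r => P s r x y) ∧
      (∀ s r, s ≤ r → r ≤ T → ∀ x y,
        P s r x y = (if x = y then 1 else 0) + ∫ u in s..r, ∑ z, P s u x z * ρ u z y) := by
  set g : ℝ → EuclideanSpace ℝ ι → EuclideanSpace ℝ ι := fun r p => forwardField (ρ r) p with hg
  have hgm : ∀ p, Measurable fun r => g r p := fun p => by
    refine Finset.measurable_sum _ fun x _ => Finset.measurable_sum _ fun y _ => ?_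
    exact ((hmeas x y).const_mul _).smul_const _
  set L : ℝ := Fintype.card ι * (Fintype.card ι * c) with hL
  have hL0 : 0 ≤ L := by positivity
  have hlip : ∀ r p q, ‖g r p - g r q‖ ≤ L * ‖p - q‖ := fun r => norm_forwardField_sub_le (hρ r)
  have hle : ∀ p ∈ probVectors ι, ∀ x, |p x| ≤ 1 := fun p hp x => by
    rw [abs_of_nonneg (hp.1 x), ← hp.2]
    exact Finset.single_le_sum (fun j _ => hp.1 j) (Finset.mem_univ x)
  have hex : ∀ (s : ℝ) (x : ι), ∃ u : ℝ → EuclideanSpace ℝ ι, s ≤ T → Continuous u ∧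
      (∀ r ∈ Icc s T, u r ∈ probVectors ι) ∧
      ∀ r ∈ Icc s T, u r = EuclideanSpace.single x 1 + ∫ q in s..r, g q (u q) := fun s x => by
    by_cases hs : s ≤ T
    · obtain ⟨u, hu⟩ := exists_solution_in_convex (K := probVectors ι) probVectors_isClosed
        probVectors_convex
        (fun p _ => hgm p) hL0 (fun r p _ q _ => hlip r p q)
        (B := L * 1) (fun r p hp => norm_forwardField_le (hρ r) zero_le_one (hle p hp))
        (by linarith : 0 < c + 1) (fun r p hp =>
          add_smul_forwardField_mem hc (hρ r) (hnn r) (hsum r) hp) hs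
        (x₀ := EuclideanSpace.single x 1) ⟨fun i => by
          by_cases h : i = x <;> simp [h], by simp⟩
      exact ⟨u, fun _ => hu⟩
    · exact ⟨fun _ => 0, fun h => absurd h hs⟩
  choose u hu using hex
  have hint : ∀ w : ℝ → EuclideanSpace ℝ ι, Continuous w → ∀ a b,
      IntervalIntegrable (fun r => g r (w r)) volume a b := fun w hw =>
    intervalIntegrable_of_le_continuous (measurable_comp_of_lipschitz hgm hlip hw.measurable)
      (continuous_const.mul hw.norm) fun r => by
        have := hlip r (w r) 0
        have h0 : g r 0 = 0 := by simp [hg, forwardField]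
        rwa [h0, sub_zero, sub_zero] at this
  have hleft : ∀ s ≤ T, ∀ x, u s x s = EuclideanSpace.single x 1 := fun s hs x => by
    simpa using (hu s x hs).2.2 s (left_mem_Icc.2 hs)
  refine ⟨fun s r x y => u s x r y, ?_, ?_, ?_, ?_, ?_, ?_⟩
  · intro s r hsr hr x y
    exact ((hu s x (hsr.trans hr)).2.1 r ⟨hsr, hr⟩).1 y
  · intro s r hsr hr x
    exact ((hu s x (hsr.trans hr)).2.1 r ⟨hsr, hr⟩).2
  · intro s hs
    ext x y
    simp [hleft s hs x, Matrix.one_apply, eq_comm]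
  · intro s t r hst htr hr
    have hs := hst.trans (htr.trans hr)
    have ht := htr.trans hr
    -- both sides solve the forward equation from time `t` with the same initial value
    ext x y
    set w : ℝ → EuclideanSpace ℝ ι := fun q => ∑ z, u s x t z • u t z q with hw
    have hwc : Continuous w := continuous_finsetSum _ fun z _ =>
      continuous_const.fun_smul (hu t z ht).1
    have hwt : w t = u s x t := by
      simp only [hw, hleft t ht, sum_smul_single]
    have hlin : ∀ q, g q (w q) = ∑ z, u s x t z • g q (u t z q) := fun q => by
      ext k
      simp only [hw, hg, forwardField_apply, WithLp.ofLp_sum, Finset.sum_apply, PiLp.smul_apply,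
        smul_eq_mul, Finset.sum_mul, Finset.mul_sum]
      rw [Finset.sum_comm]
      simp only [mul_assoc]
    have hwe : ∀ q ∈ Icc t T, w q = w t + ∫ q in t..q, g q (w q) := fun q hq => by
      simp only [hlin]
      have hi : ∀ z ∈ Finset.univ, IntervalIntegrable (fun r => u s x t z • g r (u t z r))
          volume t q := fun z _ => by
            simpa only [Pi.smul_def] using (hint _ (hu t z ht).1 t q).smul (u s x t z)
      rw [intervalIntegral.integral_finsetSum hi]
      simp only [intervalIntegral.integral_smul, hw, ← Finset.sum_add_distrib, ← smul_add]
      refine Finset.sum_congr rfl fun z _ => ?_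
      rw [hleft t ht, ← (hu t z ht).2.2 q hq]
    have hue : ∀ q ∈ Icc t T, u s x q = u s x t + ∫ q in t..q, g q (u s x q) := fun q hq => by
      have h1 := (hu s x hs).2.2 q ⟨hst.trans hq.1, hq.2⟩
      have h2 := (hu s x hs).2.2 t ⟨hst, ht⟩
      rw [h1, h2, add_assoc, intervalIntegral.integral_add_adjacent_intervals
        (hint _ (hu s x hs).1 _ _) (hint _ (hu s x hs).1 _ _)]
    have key := norm_sub_le_of_integral_equation (g := g) (K := univ) hL0
      (fun r _ p _ q _ => hlip r p q) (hu s x hs).1.continuousOn hwc.continuousOn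
      (fun _ _ => mem_univ _) (fun _ _ => mem_univ _) (hint _ (hu s x hs).1 t T)
      (hint _ hwc t T) hue hwe r ⟨htr, hr⟩
    rw [hwt, sub_self, norm_zero, zero_mul] at key
    have h0 : u s x r = w r := sub_eq_zero.1 (norm_le_zero_iff.1 key)
    change u s x r y = (Matrix.of (fun x y => u s x t y) * Matrix.of (fun x y => u t x r y)) x y
    rw [h0, Matrix.mul_apply]
    simp [hw]
  · intro s hs x y
    have := (hu s x hs).1
    fun_prop
  · intro s r hsr hr x y
    have hs := hsr.trans hr
    have h1 := congrArg (EuclideanSpace.proj (𝕜 := ℝ) y) ((hu s x hs).2.2 r ⟨hsr, hr⟩)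
    rw [map_add, ← ContinuousLinearMap.intervalIntegral_comp_comm _ (hint _ (hu s x hs).1 _ _)]
      at h1
    have e : ∀ q : EuclideanSpace ℝ ι, EuclideanSpace.proj (𝕜 := ℝ) y q = q y := fun _ => rfl
    simp only [hg, e, forwardField_apply] at h1
    beta_reduce
    rw [h1]
    simp [eq_comm]

end FiniteChain

/-! ### The generator of the empirical measure -/

/-- Jumps from an occupied state lead to the grid again. -/
theorem add_jump_mem_gridSimplex {d N : ℕ} (hN : 1 ≤ N) {x : EuclideanSpace ℝ (Fin d)}
    (hx : x ∈ gridSimplex d N) {i : Fin d} (hi : x i ≠ 0) (j : Fin d) :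
    x + (1 / (N : ℝ)) • (EuclideanSpace.single j 1 - EuclideanSpace.single i 1)
      ∈ gridSimplex d N := by
  rcases eq_or_ne i j with rfl | hij
  · simpa using hx
  obtain ⟨⟨h0, h1⟩, k, hk⟩ := hx
  have hN0 : (N : ℝ) ≠ 0 := by positivity
  have hki : 1 ≤ k i := by
    rw [Nat.one_le_iff_ne_zero]
    intro h
    exact hi (by rw [hk i, h]; simp)
  have hval : ∀ l, (x + (1 / (N : ℝ)) •
      (EuclideanSpace.single j 1 - EuclideanSpace.single i 1) : EuclideanSpace ℝ (Fin d)) l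
      = ((if l = j then k j + 1 else if l = i then k i - 1 else k l : ℕ) : ℝ) / N := fun l => by
    have e : (x + (1 / (N : ℝ)) •
      (EuclideanSpace.single j 1 - EuclideanSpace.single i 1) : EuclideanSpace ℝ (Fin d)) l
      = k l / N + 1 / N * ((if l = j then 1 else 0) - (if l = i then 1 else 0)) := by
      rw [← hk l, PiLp.add_apply, PiLp.smul_apply, PiLp.sub_apply, PiLp.single_apply,
        PiLp.single_apply, smul_eq_mul]
    rw [e]
    rcases eq_or_ne l j with rfl | hl
    · simp [hij.symm]; ring
    · rcases eq_or_ne l i with rfl | hl'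
      · simp [hl, Nat.cast_sub hki]; ring
      · simp [hl, hl']
  refine ⟨⟨fun l => ?_, ?_⟩, _, hval⟩
  · rw [hval l]; positivity
  · simp only [PiLp.add_apply, PiLp.smul_apply, PiLp.sub_apply, Finset.sum_add_distrib, h1,
      ← Finset.smul_sum, Finset.sum_sub_distrib]
    simp

theorem grid_nonempty {d N : ℕ} (hd : 0 < d) (hN : 1 ≤ N) : Nonempty (Grid d N) := by
  have hN0 : (N : ℝ) ≠ 0 := by positivity
  refine ⟨⟨EuclideanSpace.single ⟨0, hd⟩ 1, ⟨fun i => ?_, by simp⟩,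
    fun i => if i = ⟨0, hd⟩ then N else 0, fun i => ?_⟩⟩ <;>
  by_cases h : i = ⟨0, hd⟩ <;> simp [h, hN0]

theorem norm_le_one_of_mem_simplex {d : ℕ} {m : EuclideanSpace ℝ (Fin d)} (hm : m ∈ simplex d) :
    ‖m‖ ≤ 1 := by
  rw [← sum_smul_single m]
  refine (norm_sum_le _ _).trans ?_
  simp only [norm_smul, PiLp.norm_single, norm_one, mul_one, Real.norm_eq_abs]
  rw [← hm.2]
  exact Finset.sum_le_sum fun i _ => (abs_of_nonneg (hm.1 i)).le

theorem norm_sub_le_two_of_mem_simplex {d : ℕ} {m p : EuclideanSpace ℝ (Fin d)}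
    (hm : m ∈ simplex d) (hp : p ∈ simplex d) : ‖m - p‖ ≤ 2 := by
  linarith [norm_sub_le m p, norm_le_one_of_mem_simplex hm, norm_le_one_of_mem_simplex hp]

namespace Model

variable {d : ℕ} {A : Type*}

section Generator

variable {M : Model d A} {K : ℝ} {N : ℕ}

theorem sum_mul_rate_le (hK : M.BoundedBy K) {t : ℝ} (ht : t ∈ Icc 0 M.T) (a : Fin d → A)
    {m : EuclideanSpace ℝ (Fin d)} (hm : m ∈ simplex d) :
    ∑ i, ∑ j, m i * M.Q i j t (a i) m ≤ K := by
  calc ∑ i, ∑ j, m i * M.Q i j t (a i) m ≤ ∑ i, m i * K := Finset.sum_le_sum fun i _ => by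
        rw [← Finset.mul_sum]
        exact mul_le_mul_of_nonneg_left (hK.rate_le i t ht (a i) m hm) (hm.1 i)
    _ = K := by rw [← Finset.sum_mul, hm.2, one_mul]

theorem abs_sum_mul_rate_mul_le (hK : M.BoundedBy K) {t : ℝ} (ht : t ∈ Icc 0 M.T)
    (a : Fin d → A) {m : EuclideanSpace ℝ (Fin d)} (hm : m ∈ simplex d) {w : Fin d → Fin d → ℝ}
    {c : ℝ} (hc : 0 ≤ c) (hw : ∀ i j, m i ≠ 0 → |w i j| ≤ c) :
    |∑ i, ∑ j, m i * M.Q i j t (a i) m * w i j| ≤ K * c := by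
  have h : ∀ i j, |m i * M.Q i j t (a i) m * w i j| ≤ m i * M.Q i j t (a i) m * c := fun i j => by
    have h0 := mul_nonneg (hm.1 i) (hK.Q_nonneg i j t ht (a i) m hm)
    rw [abs_mul, abs_of_nonneg h0]
    rcases eq_or_ne (m i) 0 with hi | hi
    · simp [hi]
    · exact mul_le_mul_of_nonneg_left (hw i j hi) h0
  calc _ ≤ ∑ i, ∑ j, m i * M.Q i j t (a i) m * c :=
        (Finset.abs_sum_le_sum_abs _ _).trans (Finset.sum_le_sum fun i _ =>
          (Finset.abs_sum_le_sum_abs _ _).trans (Finset.sum_le_sum fun j _ => h i j))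
    _ = (∑ i, ∑ j, m i * M.Q i j t (a i) m) * c := by simp only [Finset.sum_mul]
    _ ≤ K * c := mul_le_mul_of_nonneg_right (sum_mul_rate_le hK ht a hm) hc

theorem abs_generator_le (hK : M.BoundedBy K) (hN : 1 ≤ N) {t : ℝ} (ht : t ∈ Icc 0 M.T)
    (a : Fin d → A) (x : Grid d N) {v : EuclideanSpace ℝ (Fin d) → ℝ} {c : ℝ} (hc : 0 ≤ c)
    (hv : ∀ y : Grid d N, |v y - v x| ≤ c) : |M.generator N t a v x| ≤ N * K * c := by
  rw [generator, abs_mul, Nat.abs_cast, mul_assoc]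
  refine mul_le_mul_of_nonneg_left ?_ (Nat.cast_nonneg N)
  exact abs_sum_mul_rate_mul_le hK ht a x.2.1 hc fun i j hi =>
    hv ⟨_, add_jump_mem_gridSimplex hN x.2 hi j⟩

/-- On the grid the generator only sees the values on the grid: targets outside carry zero rate. -/
theorem generator_congr (hN : 1 ≤ N) (t : ℝ) (a : Fin d → A) (x : Grid d N)
    {v w : EuclideanSpace ℝ (Fin d) → ℝ} (h : ∀ y : Grid d N, v y = w y) :
    M.generator N t a v x = M.generator N t a w x := by
  rw [generator, generator]
  congr 1
  refine Finset.sum_congr rfl fun i _ => Finset.sum_congr rfl fun j _ => ?_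
  rcases eq_or_ne ((x : EuclideanSpace ℝ (Fin d)) i) 0 with hi | hi
  · simp [hi]
  · rw [h x, h ⟨_, add_jump_mem_gridSimplex hN x.2 hi j⟩]

theorem generator_sum {κ : Type*} (s : Finset κ) (c : κ → ℝ)
    (v : κ → EuclideanSpace ℝ (Fin d) → ℝ) (t : ℝ) (a : Fin d → A)
    (m : EuclideanSpace ℝ (Fin d)) :
    M.generator N t a (fun z => ∑ k ∈ s, c k * v k z) m
      = ∑ k ∈ s, c k * M.generator N t a (v k) m := by
  simp only [generator, ← Finset.sum_sub_distrib, ← mul_sub, Finset.mul_sum]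
  symm
  rw [Finset.sum_comm]
  refine Finset.sum_congr rfl fun i _ => ?_
  rw [Finset.sum_comm]
  refine Finset.sum_congr rfl fun j _ => Finset.sum_congr rfl fun k _ => ?_
  ring

/-- The rate matrix of the chain of empirical measures: its entries are the values of the
generator at the indicator functions of points. -/
noncomputable def gridRate (M : Model d A) (N : ℕ) (t : ℝ) (a : Fin d → A) (x y : Grid d N) : ℝ :=
  M.generator N t a (Set.indicator {(y : EuclideanSpace ℝ (Fin d))} 1) x

theorem eq_sum_indicator (v : EuclideanSpace ℝ (Fin d) → ℝ) (x : Grid d N) :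
    v x = ∑ y : Grid d N, v y *
      Set.indicator {(y : EuclideanSpace ℝ (Fin d))} (1 : EuclideanSpace ℝ (Fin d) → ℝ) x := by
  rw [Finset.sum_eq_single x]
  · simp
  · intro y _ hy
    have : (x : EuclideanSpace ℝ (Fin d)) ≠ y := fun h => hy (Subtype.ext h.symm)
    simp [this]
  · simp

theorem generator_eq_sum (hN : 1 ≤ N) (t : ℝ) (a : Fin d → A)
    (v : EuclideanSpace ℝ (Fin d) → ℝ) (x : Grid d N) :
    M.generator N t a v x = ∑ y : Grid d N, v y * M.gridRate N t a x y := by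
  rw [generator_congr hN t a x (w := fun z => ∑ y : Grid d N, v y *
    Set.indicator {(y : EuclideanSpace ℝ (Fin d))} 1 z) (eq_sum_indicator v), generator_sum]
  rfl

theorem abs_indicator_sub_le {Z : Type*} (s : Set Z) (x y : Z) :
    |s.indicator (1 : Z → ℝ) x - s.indicator 1 y| ≤ 1 := by
  by_cases hx : x ∈ s <;> by_cases hy : y ∈ s <;> simp [hx, hy]

theorem abs_gridRate_le (hK : M.BoundedBy K) (hN : 1 ≤ N) {t : ℝ} (ht : t ∈ Icc 0 M.T)
    (a : Fin d → A) (x y : Grid d N) : |M.gridRate N t a x y| ≤ N * K := by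
  rw [← mul_one (N * K)]
  exact abs_generator_le hK hN ht a x zero_le_one fun z => abs_indicator_sub_le _ _ _

theorem gridRate_nonneg (hK : M.BoundedBy K) {t : ℝ} (ht : t ∈ Icc 0 M.T)
    (a : Fin d → A) {x y : Grid d N} (hxy : x ≠ y) : 0 ≤ M.gridRate N t a x y := by
  have hxy' : (x : EuclideanSpace ℝ (Fin d)) ≠ y := fun h => hxy (Subtype.ext h)
  refine mul_nonneg (Nat.cast_nonneg N) (Finset.sum_nonneg fun i _ => Finset.sum_nonneg fun j _ =>
    mul_nonneg (mul_nonneg (x.2.1.1 i) (hK.Q_nonneg i j t ht _ _ x.2.1)) ?_)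
  rw [Set.indicator_of_notMem (a := (x : EuclideanSpace ℝ (Fin d))) (by simpa using hxy'),
    sub_zero]
  exact Set.indicator_nonneg (fun _ _ => zero_le_one) _

theorem sum_gridRate (hN : 1 ≤ N) (t : ℝ) (a : Fin d → A) (x : Grid d N) :
    ∑ y, M.gridRate N t a x y = 0 := by
  have h := generator_eq_sum (M := M) hN t a (fun _ => 1) x
  simp only [one_mul] at h
  rw [← h]
  simp [generator]

/-- On the squared distance to a point `c` the generator is the derivative along the velocity, up
to the quadratic variation of the jumps, which is of order `1 / N`. -/
theorem generator_sq_dist_le (hK : M.BoundedBy K) (hN : 1 ≤ N) {t : ℝ} (ht : t ∈ Icc 0 M.T)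
    (a : Fin d → A) {m : EuclideanSpace ℝ (Fin d)} (hm : m ∈ simplex d)
    (c : EuclideanSpace ℝ (Fin d)) :
    M.generator N t a (fun z => ‖z - c‖ ^ 2) m
      ≤ 2 * inner ℝ (m - c) (M.velocity t a m) + 4 * K / N := by
  have hN0 : (N : ℝ) ≠ 0 := by positivity
  have hN1 : (0 : ℝ) ≤ N := Nat.cast_nonneg N
  have e : M.generator N t a (fun z => ‖z - c‖ ^ 2) m
      = 2 * inner ℝ (m - c) (M.velocity t a m) + 1 / N * ∑ i, ∑ j, m i * M.Q i j t (a i) m *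
        ‖(EuclideanSpace.single j (1 : ℝ) - EuclideanSpace.single i 1 :
          EuclideanSpace ℝ (Fin d))‖ ^ 2 := by
    simp only [generator, velocity, inner_sum, inner_smul_right, Finset.mul_sum,
      ← Finset.sum_add_distrib]
    refine Finset.sum_congr rfl fun i _ => Finset.sum_congr rfl fun j _ => ?_
    set w : EuclideanSpace ℝ (Fin d) := EuclideanSpace.single j (1 : ℝ) - EuclideanSpace.single i 1
    have : m + (1 / (N : ℝ)) • w - c = (m - c) + (1 / (N : ℝ)) • w := by abel
    rw [this, norm_add_sq_real, inner_smul_right, norm_smul, mul_pow, Real.norm_eq_abs, sq_abs]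
    field_simp
    ring
  have h := (le_abs_self _).trans (abs_sum_mul_rate_mul_le hK ht a hm (c := 4)
    (w := fun i j => ‖(EuclideanSpace.single j (1 : ℝ) - EuclideanSpace.single i 1 :
          EuclideanSpace ℝ (Fin d))‖ ^ 2) (by norm_num) fun i j _ => by
      rw [abs_of_nonneg (by positivity)]
      nlinarith [norm_single_sub_single_le i j, norm_nonneg
        (EuclideanSpace.single j (1 : ℝ) - EuclideanSpace.single i 1 : EuclideanSpace ℝ (Fin d))])
  rw [e]
  have h2 := mul_le_mul_of_nonneg_left h (by positivity : (0 : ℝ) ≤ 1 / N)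
  have h3 : 1 / (N : ℝ) * (K * 4) = 4 * K / N := by ring
  linarith

theorem Regular.generator_continuousOn [TopologicalSpace A] (hM : M.Regular) (N : ℕ)
    (v : EuclideanSpace ℝ (Fin d) → ℝ) {m : EuclideanSpace ℝ (Fin d)} (hm : m ∈ simplex d) :
    ContinuousOn (fun z : ℝ × (Fin d → A) × EuclideanSpace ℝ (Fin d) =>
      M.generator N z.1 z.2.1 v m) (Icc 0 M.T ×ˢ univ ×ˢ simplex d) := by
  refine continuousOn_const.mul (continuousOn_finsetSum _ fun i _ =>
    continuousOn_finsetSum _ fun j _ => ?_)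
  refine (continuousOn_const.mul ?_).mul continuousOn_const
  exact (hM.Q_continuous i j).comp (f := fun z : ℝ × (Fin d → A) × EuclideanSpace ℝ (Fin d) =>
    (z.1, z.2.1 i, m)) (by fun_prop) fun z hz => ⟨hz.1, mem_univ _, hm⟩

theorem exists_bound_generator (hK : M.BoundedBy K) (hN : 1 ≤ N) (a : ℝ → Fin d → A)
    (v : EuclideanSpace ℝ (Fin d) → ℝ) (x : Grid d N) :
    ∃ B, ∀ s ∈ Icc 0 M.T, |M.generator N s (a s) v x| ≤ B :=
  ⟨_, fun _ hs => abs_generator_le hK hN hs _ x (c := ∑ y : Grid d N, |v y - v x|)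
    (Finset.sum_nonneg fun _ _ => abs_nonneg _)
    fun y => Finset.single_le_sum (f := fun y : Grid d N => |v y - v x|)
      (fun _ _ => abs_nonneg _) (Finset.mem_univ y)⟩

end Generator

section Chain

variable [MetricSpace A] [CompactSpace A] [MeasurableSpace A] [BorelSpace A] {M : Model d A}
  {K : ℝ} {N : ℕ}

theorem Regular.measurable_indicator_generator (hM : M.Regular) (N : ℕ)
    (v : EuclideanSpace ℝ (Fin d) → ℝ) {m : EuclideanSpace ℝ (Fin d)} (hm : m ∈ simplex d)
    {α : ℝ → Fin d → A} (hα : Measurable α) :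
    Measurable ((Icc 0 M.T).indicator fun s => M.generator N s (α s) v m) :=
  measurable_indicator_along (φ := fun s a _ => M.generator N s a v m)
    (μ := fun _ => m) (hM.generator_continuousOn N v hm) le_rfl hα
    continuousOn_const fun _ _ => hm

theorem Regular.generator_intervalIntegrable (hM : M.Regular) (hK : M.BoundedBy K) (hN : 1 ≤ N)
    (v : EuclideanSpace ℝ (Fin d) → ℝ) (x : Grid d N)
    {α : ℝ → Fin d → A} (hα : Measurable α) {p q : ℝ} (hp : p ∈ Icc 0 M.T)
    (hq : q ∈ Icc 0 M.T) :
    IntervalIntegrable (fun s => M.generator N s (α s) v x) volume p q := by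
  obtain ⟨B, hB⟩ := exists_bound_generator hK hN α v x
  exact intervalIntegrable_of_indicator (hM.measurable_indicator_generator N v x.2.1 hα) hB hp hq

/-- Every measurable feedback control drives a chain. -/
theorem exists_isTransitionFunction (hM : M.Regular) (hK : M.BoundedBy K) (hN : 1 ≤ N)
    {α : ℝ → Grid d N → Fin d → A} (hα : ∀ y, Measurable fun s => α s y) :
    ∃ P, M.IsTransitionFunction N α P := by
  have hNK : 0 ≤ N * K := mul_nonneg (Nat.cast_nonneg N) hK.nonneg
  set ρ : ℝ → Grid d N → Grid d N → ℝ := fun r x y =>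
    (Icc 0 M.T).indicator (fun r => M.gridRate N r (α r x) x y) r with hρdef
  have hin : ∀ r ∈ Icc 0 M.T, ∀ x y, ρ r x y = M.gridRate N r (α r x) x y := fun r hr x y =>
    indicator_of_mem hr _
  have hout : ∀ r, r ∉ Icc 0 M.T → ∀ x y, ρ r x y = 0 := fun r hr x y =>
    indicator_of_notMem hr _
  have hmeas : ∀ x y, Measurable fun r => ρ r x y := fun x y =>
    hM.measurable_indicator_generator N _ x.2.1 (hα x)
  have hbd : ∀ r x y, |ρ r x y| ≤ N * K := fun r x y => by
    by_cases hr : r ∈ Icc 0 M.T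
    · rw [hin r hr]; exact abs_gridRate_le hK hN hr _ x y
    · rw [hout r hr, abs_zero]; exact hNK
  obtain ⟨P, h1, h2, h3, h4, h5, h6⟩ := exists_transitionMatrix hNK hmeas hbd
    (fun r x y hxy => by
      by_cases hr : r ∈ Icc 0 M.T
      · rw [hin r hr]; exact gridRate_nonneg hK hr _ hxy
      · rw [hout r hr])
    (fun r x => by
      by_cases hr : r ∈ Icc 0 M.T
      · simp only [hin r hr]; exact sum_gridRate hN _ _ x
      · simp only [hout r hr, Finset.sum_const_zero]) M.T
  refine ⟨P, fun s r _ => h1 s r, fun s r _ => h2 s r, fun s hs => h3 s hs.2,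
    fun s u r _ => h4 s u r, fun s hs x y => (h5 s hs.2 x y).continuousOn, ?_⟩
  intro s r hs hsr hr v x
  have hint : ∀ y z, IntervalIntegrable (fun u => P s u x z * ρ u z y) volume s r := fun y z =>
    (intervalIntegrable_of_le_continuous (hmeas z y) continuous_const
      (fun r => hbd r z y) s r).continuousOn_mul (h5 s (hsr.trans hr) x z).continuousOn
  have hint' : ∀ y, IntervalIntegrable (fun u => ∑ z, P s u x z * ρ u z y) volume s r := fun y => by
    have h := IntervalIntegrable.sum Finset.univ fun z _ => hint y z
    exact h.congr fun u _ => by simp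
  simp only [h6 s r hsr hr x, add_mul, Finset.sum_add_distrib, ite_mul, one_mul, zero_mul,
    Finset.sum_ite_eq, Finset.mem_univ, if_true]
  congr 1
  simp only [← intervalIntegral.integral_mul_const]
  rw [← intervalIntegral.integral_finsetSum fun y _ => (hint' y).mul_const _]
  refine intervalIntegral.integral_congr fun u hu => ?_
  rw [uIcc_of_le hsr] at hu
  have hu' : u ∈ Icc 0 M.T := ⟨hs.trans hu.1, hu.2.trans hr⟩
  simp only [generator_eq_sum hN, hin u hu', Finset.sum_mul, Finset.mul_sum]
  rw [Finset.sum_comm]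
  refine Finset.sum_congr rfl fun y _ => Finset.sum_congr rfl fun z _ => ?_
  ring

end Chain
end Model

/-! ### Estimates for the controlled chain -/

namespace Model

variable {d : ℕ} {A : Type*}

section TransitionFunction

variable {M : Model d A} {K : ℝ} {N : ℕ} {α : ℝ → Grid d N → Fin d → A}
  {P : ℝ → ℝ → Matrix (Grid d N) (Grid d N) ℝ}

theorem IsTransitionFunction.sum_mul_le (hP : M.IsTransitionFunction N α P) {s r : ℝ}
    (hs : 0 ≤ s) (hsr : s ≤ r) (hr : r ≤ M.T) (x : Grid d N) {h : Grid d N → ℝ} {c : ℝ}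
    (hc : ∀ y, h y ≤ c) : ∑ y, P s r x y * h y ≤ c := by
  calc _ ≤ ∑ y, P s r x y * c := Finset.sum_le_sum fun y _ =>
        mul_le_mul_of_nonneg_left (hc y) (hP.nonneg s r hs hsr hr x y)
    _ = c := by rw [← Finset.sum_mul, hP.sum_eq_one s r hs hsr hr x, one_mul]

theorem IsTransitionFunction.abs_sum_mul_le (hP : M.IsTransitionFunction N α P) {s r : ℝ}
    (hs : 0 ≤ s) (hsr : s ≤ r) (hr : r ≤ M.T) (x : Grid d N) {h : Grid d N → ℝ} {c : ℝ}
    (hc : ∀ y, |h y| ≤ c) : |∑ y, P s r x y * h y| ≤ c := by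
  rw [abs_le]
  constructor
  · have := hP.sum_mul_le hs hsr hr x (h := fun y => -h y) (c := c)
      fun y => by linarith [(abs_le.1 (hc y)).1]
    simp only [mul_neg, Finset.sum_neg_distrib] at this
    linarith
  · exact hP.sum_mul_le hs hsr hr x fun y => (abs_le.1 (hc y)).2

/-- The probability of leaving a point within time `r - s` is at most `N K (r - s)`. -/
theorem IsTransitionFunction.one_sub_le (hP : M.IsTransitionFunction N α P) (hK : M.BoundedBy K)
    (hN : 1 ≤ N) {s r : ℝ} (hs : 0 ≤ s) (hsr : s ≤ r) (hr : r ≤ M.T) (x : Grid d N) :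
    1 - P s r x x ≤ N * K * (r - s) := by
  have h := hP.forward s r hs hsr hr (Set.indicator {(x : EuclideanSpace ℝ (Fin d))} 1) x
  have h1 : ∑ y, P s r x y * Set.indicator {(x : EuclideanSpace ℝ (Fin d))}
      (1 : EuclideanSpace ℝ (Fin d) → ℝ) y = P s r x x := by
    rw [Finset.sum_eq_single x]
    · simp
    · intro y _ hy
      have : (y : EuclideanSpace ℝ (Fin d)) ≠ x := fun h => hy (Subtype.ext h)
      simp [this]
    · simp
  have h2 := intervalIntegral.norm_integral_le_of_norm_le_const (a := s) (b := r) (C := N * K)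
    (f := fun u => ∑ y, P s u x y * M.generator N u (α u y)
      (Set.indicator {(x : EuclideanSpace ℝ (Fin d))} 1) y) fun u hu => by
      rw [uIoc_of_le hsr] at hu
      refine hP.abs_sum_mul_le hs hu.1.le (hu.2.trans hr) x fun y => ?_
      rw [← mul_one (N * K)]
      exact abs_generator_le hK hN ⟨hs.trans hu.1.le, hu.2.trans hr⟩ _ y zero_le_one
        fun z => abs_indicator_sub_le _ _ _
  rw [abs_of_nonneg (sub_nonneg.2 hsr), Real.norm_eq_abs] at h2
  rw [h1] at h
  have h3 : Set.indicator {(x : EuclideanSpace ℝ (Fin d))}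
      (1 : EuclideanSpace ℝ (Fin d) → ℝ) x = 1 := by simp
  linarith [(abs_le.1 h2).1]

/-- Over a short time, expectations differ little from the value at the starting point. -/
theorem IsTransitionFunction.abs_sum_mul_sub_le (hP : M.IsTransitionFunction N α P)
    (hK : M.BoundedBy K) (hN : 1 ≤ N) {s r : ℝ} (hs : 0 ≤ s) (hsr : s ≤ r) (hr : r ≤ M.T)
    (x : Grid d N) {h : Grid d N → ℝ} {c : ℝ} (hc0 : 0 ≤ c) (hc : ∀ y, |h y - h x| ≤ c) :
    |∑ y, P s r x y * h y - h x| ≤ c * (N * K * (r - s)) := by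
  have hsum := hP.sum_eq_one s r hs hsr hr x
  have e : ∑ y, P s r x y * h y - h x = ∑ y ∈ Finset.univ.erase x, P s r x y * (h y - h x) := by
    have : ∑ y, P s r x y * (h y - h x) = ∑ y, P s r x y * h y - h x := by
      simp only [mul_sub, Finset.sum_sub_distrib, ← Finset.sum_mul, hsum, one_mul]
    rw [← this, ← Finset.add_sum_erase _ _ (Finset.mem_univ x)]
    simp
  rw [← Finset.add_sum_erase _ _ (Finset.mem_univ x)] at hsum
  rw [e]
  calc _ ≤ ∑ y ∈ Finset.univ.erase x, P s r x y * c :=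
        (Finset.abs_sum_le_sum_abs _ _).trans (Finset.sum_le_sum fun y _ => by
          rw [abs_mul, abs_of_nonneg (hP.nonneg s r hs hsr hr x y)]
          exact mul_le_mul_of_nonneg_left (hc y) (hP.nonneg s r hs hsr hr x y))
    _ = c * (1 - P s r x x) := by rw [← Finset.sum_mul, ← hsum]; ring
    _ ≤ _ := mul_le_mul_of_nonneg_left (hP.one_sub_le hK hN hs hsr hr x) hc0

theorem IsTransitionFunction.abs_integral_F_le (hP : M.IsTransitionFunction N α P)
    (hK : M.BoundedBy K) {s r : ℝ} (hs : 0 ≤ s) (hsr : s ≤ r) (hr : r ≤ M.T) (x : Grid d N) :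
    |∫ u in s..r, ∑ y, P s u x y * M.F u (α u y) y| ≤ K * (r - s) := by
  have := intervalIntegral.norm_integral_le_of_norm_le_const (a := s) (b := r) (C := K)
    (f := fun u => ∑ y, P s u x y * M.F u (α u y) y) fun u hu => by
      rw [uIoc_of_le hsr] at hu
      exact hP.abs_sum_mul_le hs hu.1.le (hu.2.trans hr) x fun y =>
        hK.F_le u ⟨hs.trans hu.1.le, hu.2.trans hr⟩ _ _ y.2.1
  rwa [abs_of_nonneg (sub_nonneg.2 hsr)] at this

theorem IsTransitionFunction.abs_costN_le (hP : M.IsTransitionFunction N α P)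
    (hK : M.BoundedBy K) {t : ℝ} (ht : t ∈ Icc 0 M.T) (x : Grid d N) :
    |M.costN N α P t x| ≤ K * (M.T + 1) := by
  have h1 := hP.abs_integral_F_le hK ht.1 ht.2 le_rfl x
  have h2 := hP.abs_sum_mul_le ht.1 ht.2 le_rfl x (h := fun y => M.G y)
    fun y => hK.G_le _ y.2.1
  have h3 := mul_le_mul_of_nonneg_left (by linarith [ht.1] : M.T - t ≤ M.T) hK.nonneg
  exact (abs_add_le _ _).trans (by linarith)

theorem valueN_le_costN [MeasurableSpace A] (hK : M.BoundedBy K) {t : ℝ} (ht : t ∈ Icc 0 M.T)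
    (hα : ∀ y, Measurable fun s => α s y) (hP : M.IsTransitionFunction N α P) (x : Grid d N) :
    M.valueN N t x ≤ M.costN N α P t x := by
  refine csInf_le ⟨-(K * (M.T + 1)), ?_⟩ ⟨α, P, hα, hP, rfl⟩
  rintro _ ⟨α', P', -, hP', rfl⟩
  exact (abs_le.1 (hP'.abs_costN_le hK ht x)).1

theorem IsTransitionFunction.intervalIntegrable_sum (hP : M.IsTransitionFunction N α P) {s : ℝ}
    (hs : 0 ≤ s) {p q : ℝ} (hp : p ∈ Icc s M.T) (hq : q ∈ Icc s M.T) (x : Grid d N)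
    {h : ℝ → Grid d N → ℝ} (hh : ∀ y, IntervalIntegrable (fun u => h u y) volume p q) :
    IntervalIntegrable (fun u => ∑ y, P s u x y * h u y) volume p q := by
  have h1 := IntervalIntegrable.sum Finset.univ fun y _ => (hh y).continuousOn_mul
    (g := fun u => P s u x y) ((hP.continuous s ⟨hs, hp.1.trans hp.2⟩ x y).mono
      (uIcc_subset_Icc hp hq))
  exact h1.congr fun u _ => by simp

end TransitionFunction

section Chain

variable [MetricSpace A] [CompactSpace A] [MeasurableSpace A] [BorelSpace A] {M : Model d A}
  {K : ℝ} {N : ℕ} {α : ℝ → Grid d N → Fin d → A} {P : ℝ → ℝ → Matrix (Grid d N) (Grid d N) ℝ}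

theorem le_valueN [Nonempty A] (hM : M.Regular) (hK : M.BoundedBy K) (hN : 1 ≤ N) {t : ℝ}
    {x : Grid d N} {c : ℝ}
    (hc : ∀ α P, (∀ y, Measurable fun s => α s y) → M.IsTransitionFunction N α P →
      c ≤ M.costN N α P t x) :
    c ≤ M.valueN N t x := by
  refine le_csInf ?_ ?_
  · have hα : ∀ y : Grid d N, Measurable fun s : ℝ =>
        (fun (_ : ℝ) (_ : Grid d N) (_ : Fin d) => Classical.arbitrary A) s y :=
      fun _ => measurable_const
    obtain ⟨P, hP⟩ := exists_isTransitionFunction hM hK hN hα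
    exact ⟨_, _, P, hα, hP, rfl⟩
  · rintro _ ⟨α, P, hα, hP, rfl⟩
    exact hc α P hα hP

theorem Regular.F_intervalIntegrable_const (hM : M.Regular) (hK : M.BoundedBy K)
    {β : ℝ → Fin d → A} (hβ : Measurable β) {m : EuclideanSpace ℝ (Fin d)} (hm : m ∈ simplex d)
    {p q : ℝ} (hp : p ∈ Icc 0 M.T) (hq : q ∈ Icc 0 M.T) :
    IntervalIntegrable (fun s => M.F s (β s) m) volume p q :=
  hM.F_intervalIntegrable hK le_rfl hβ continuousOn_const (fun _ _ => hm) hp hq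

/-- The Markov property of the expected cost. -/
theorem IsTransitionFunction.costN_eq (hP : M.IsTransitionFunction N α P) (hM : M.Regular)
    (hK : M.BoundedBy K) (hα : ∀ y, Measurable fun s => α s y) {t s : ℝ} (ht : 0 ≤ t)
    (hs : s ∈ Icc t M.T) (x : Grid d N) :
    M.costN N α P t x = (∫ u in t..s, ∑ y, P t u x y * M.F u (α u y) y)
      + ∑ z, P t s x z * M.costN N α P s z := by
  have hT : t ≤ M.T := hs.1.trans hs.2
  have hs0 := ht.trans hs.1
  have hl := left_mem_Icc.2 hT
  have hr := right_mem_Icc.2 hT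
  have hF : ∀ p ∈ Icc 0 M.T, ∀ q ∈ Icc 0 M.T, ∀ y : Grid d N,
      IntervalIntegrable (fun u => M.F u (α u y) y) volume p q := fun p hp q hq y =>
    hM.F_intervalIntegrable_const hK (hα y) y.2.1 hp hq
  have hsub : ∀ {r}, r ∈ Icc t M.T → r ∈ Icc 0 M.T := fun h => ⟨ht.trans h.1, h.2⟩
  have h1 := intervalIntegral.integral_add_adjacent_intervals
    (hP.intervalIntegrable_sum ht hl hs x (hF t (hsub hl) s (hsub hs)))
    (hP.intervalIntegrable_sum ht hs hr x (hF s (hsub hs) M.T (hsub hr)))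
  have hCK : ∀ u ∈ Icc s M.T, ∀ h : Grid d N → ℝ,
      ∑ y, P t u x y * h y = ∑ z, P t s x z * ∑ y, P s u z y * h y := fun u hu h => by
    simp only [hP.chapman_kolmogorov t s u ht hs.1 hu.1 hu.2, Matrix.mul_apply, Finset.sum_mul,
      Finset.mul_sum, mul_assoc]
    rw [Finset.sum_comm]
  have h2 : ∫ u in s..M.T, ∑ y, P t u x y * M.F u (α u y) y
      = ∑ z, P t s x z * ∫ u in s..M.T, ∑ y, P s u z y * M.F u (α u y) y := by
    simp only [← intervalIntegral.integral_const_mul]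
    rw [← intervalIntegral.integral_finsetSum fun z _ =>
      (hP.intervalIntegrable_sum hs0 (left_mem_Icc.2 hs.2) (right_mem_Icc.2 hs.2) z
        (hF s (hsub hs) M.T (hsub hr))).const_mul _]
    refine intervalIntegral.integral_congr fun u hu => ?_
    rw [uIcc_of_le hs.2] at hu
    exact hCK u hu fun y => M.F u (α u y) y
  simp only [costN, mul_add, Finset.sum_add_distrib]
  rw [← h1, h2, hCK M.T (right_mem_Icc.2 hs.2) fun y => M.G y, add_assoc]

/-- For a fixed number of agents the value function is Lipschitz in time. -/
theorem abs_valueN_sub_valueN_le [Nonempty A] (hM : M.Regular) (hK : M.BoundedBy K) (hN : 1 ≤ N)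
    {t s : ℝ} (ht : 0 ≤ t) (hts : t ≤ s) (hs : s ≤ M.T) (x : Grid d N) :
    |M.valueN N t x - M.valueN N s x|
      ≤ (K + 2 * (K * (M.T + 1)) * (N * K)) * (s - t) := by
  have key : ∀ α P, (∀ y, Measurable fun s => α s y) → M.IsTransitionFunction N α P →
      |M.costN N α P t x - M.costN N α P s x|
        ≤ (K + 2 * (K * (M.T + 1)) * (N * K)) * (s - t) := fun α P hα hP => by
    have hsI : s ∈ Icc 0 M.T := ⟨ht.trans hts, hs⟩
    have hb := fun y => hP.abs_costN_le hK hsI y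
    have h0 : 0 ≤ K * (M.T + 1) := (abs_nonneg _).trans (hb x)
    have h1 := hP.abs_integral_F_le hK ht hts hs x
    have h2 := hP.abs_sum_mul_sub_le hK hN ht hts hs x (h := fun y => M.costN N α P s y)
      (c := 2 * (K * (M.T + 1))) (by positivity)
      fun y => (abs_sub _ _).trans (by linarith [hb x, hb y])
    rw [hP.costN_eq hM hK hα ht ⟨hts, hs⟩ x, add_sub_assoc]
    refine (abs_add_le _ _).trans ((add_le_add h1 h2).trans_eq ?_)
    ring
  rw [abs_sub_le_iff]
  constructor
  · rw [sub_le_comm]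
    refine le_valueN hM hK hN fun α P hα hP => ?_
    linarith [valueN_le_costN hK ⟨ht, hts.trans hs⟩ hα hP x, (abs_le.1 (key α P hα hP)).2]
  · rw [sub_le_comm]
    refine le_valueN hM hK hN fun α P hα hP => ?_
    linarith [valueN_le_costN hK ⟨ht.trans hts, hs⟩ hα hP x, (abs_le.1 (key α P hα hP)).1]

/-- Running costs of the chain and of the trajectory driven by the action that the feedback
prescribes at the starting point of the chain. -/
theorem IsTransitionFunction.abs_integral_F_sub_le (hP : M.IsTransitionFunction N α P)
    (hM : M.Regular) (hK : M.BoundedBy K) (hN : 1 ≤ N) (hα : ∀ y, Measurable fun s => α s y)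
    {s r : ℝ} (hs : 0 ≤ s) (hr : r ∈ Icc s M.T) (x : Grid d N) {y : EuclideanSpace ℝ (Fin d)}
    {μ : ℝ → EuclideanSpace ℝ (Fin d)} (hμ : M.IsTrajectory (fun u => α u x) s y μ) :
    |(∫ u in s..r, ∑ z, P s u x z * M.F u (α u z) z) - ∫ u in s..r, M.F u (α u x) (μ u)|
      ≤ K * (r - s) * ‖x - y‖ + (8 * N + 7) * K ^ 2 * (r - s) ^ 2 := by
  have hK0 := hK.nonneg
  have hT : s ≤ M.T := hr.1.trans hr.2
  have hl := left_mem_Icc.2 hT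
  have hsub : ∀ {u}, u ∈ Icc s M.T → u ∈ Icc 0 M.T := fun h => ⟨hs.trans h.1, h.2⟩
  rw [← intervalIntegral.integral_sub
    (hP.intervalIntegrable_sum hs hl hr x fun z =>
      hM.F_intervalIntegrable_const hK (hα z) z.2.1 (hsub hl) (hsub hr))
    (hM.F_intervalIntegrable hK hs (hα x) hμ.continuous hμ.mem_simplex hl hr)]
  have h := intervalIntegral.norm_integral_le_of_norm_le_const (a := s) (b := r)
    (C := 2 * K * (N * K * (r - s)) + K * (‖x - y‖ + K * (r - s)))
    (f := fun u => ∑ z, P s u x z * M.F u (α u z) z - M.F u (α u x) (μ u)) fun u hu => by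
      rw [uIoc_of_le hr.1] at hu
      have huI : u ∈ Icc s M.T := ⟨hu.1.le, hu.2.trans hr.2⟩
      have h1 := hP.abs_sum_mul_sub_le hK hN hs huI.1 huI.2 x (h := fun z => M.F u (α u z) z)
        (c := 2 * K) (by positivity) fun z => (abs_sub _ _).trans (by
          linarith [hK.F_le u (hsub huI) (α u x) x x.2.1, hK.F_le u (hsub huI) (α u z) z z.2.1])
      have h2 := hK.F_lipschitz u (hsub huI) (α u x) x x.2.1 _ (hμ.mem_simplex u huI)
      have h3 := hμ.norm_sub_le hM hK hs (hα x) huI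
      have h4 : ‖(x : EuclideanSpace ℝ (Fin d)) - μ u‖ ≤ ‖x - y‖ + K * (r - s) := by
        have h5 := norm_sub_le_norm_sub_add_norm_sub (x : EuclideanSpace ℝ (Fin d)) y (μ u)
        rw [norm_sub_rev y] at h5
        have h6 := mul_le_mul_of_nonneg_left (by linarith [hu.2] : u - s ≤ r - s) hK0
        linarith
      have h7 : 2 * K * (N * K * (u - s)) ≤ 2 * K * (N * K * (r - s)) := by
        have := hu.2
        gcongr
      rw [Real.norm_eq_abs, ← sub_add_sub_cancel _ (M.F u (α u x) x)]
      refine (abs_add_le _ _).trans (add_le_add (h1.trans h7) ?_)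
      exact h2.trans (mul_le_mul_of_nonneg_left h4 hK0)
  rw [abs_of_nonneg (sub_nonneg.2 hr.1)] at h
  refine h.trans ?_
  have hN0 : (0 : ℝ) ≤ N := Nat.cast_nonneg N
  have : 0 ≤ (6 * N + 6) * K ^ 2 * (r - s) ^ 2 := by positivity
  linarith

/-- The squared distance between the chain and the trajectory grows at a controlled rate: the
drifts match up to the Lipschitz constant of the velocity, and the jumps contribute `O(1 / N)`. -/
theorem IsTransitionFunction.sum_sq_dist_le (hP : M.IsTransitionFunction N α P)
    (hM : M.Regular) (hK : M.BoundedBy K) (hN : 1 ≤ N) (hα : ∀ y, Measurable fun s => α s y)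
    {s r : ℝ} (hs : 0 ≤ s) (hr : r ∈ Icc s M.T) (x : Grid d N) {y : EuclideanSpace ℝ (Fin d)}
    {μ : ℝ → EuclideanSpace ℝ (Fin d)} (hμ : M.IsTrajectory (fun u => α u x) s y μ) :
    ∑ z, P s r x z * ‖z - μ r‖ ^ 2
      ≤ (1 + 2 * K * (r - s)) * ‖x - y‖ ^ 2 + 4 * K / N * (r - s)
        + (8 * N + 7) * K ^ 2 * (r - s) ^ 2 := by
  have hK0 := hK.nonneg
  have hN0 : (0 : ℝ) ≤ N := Nat.cast_nonneg N
  have hT : s ≤ M.T := hr.1.trans hr.2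
  have hl := left_mem_Icc.2 hT
  have hh : 0 ≤ r - s := sub_nonneg.2 hr.1
  have hsub : ∀ {u}, u ∈ Icc s M.T → u ∈ Icc 0 M.T := fun h => ⟨hs.trans h.1, h.2⟩
  have hy : y ∈ simplex d := by rw [← hμ.left_eq hT]; exact hμ.mem_simplex s hl
  have hμr := hμ.mem_simplex r hr
  have hIγ := hM.velocity_intervalIntegrable hK le_rfl (hα x) (μ := fun _ => x)
    continuousOn_const (fun _ _ => x.2.1) (hsub hl) (hsub hr)
  have hIβ := hM.velocity_intervalIntegrable hK hs (hα x) hμ.continuous hμ.mem_simplex hl hr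
  set X : EuclideanSpace ℝ (Fin d) := x.1 with hX
  set β := ∫ u in s..r, M.velocity u (α u x) (μ u) with hβ
  set γ := ∫ u in s..r, M.velocity u (α u x) X with hγ
  have hμβ : μ r = y + β := ((isTrajectory_iff hM hK hs (hα x)).1 hμ).2.2 r hr
  -- the generator applied to the squared distance, with its value at `x` frozen
  have hgen : ∀ u ∈ Icc s r, ∑ z, P s u x z * M.generator N u (α u z) (fun w => ‖w - μ r‖ ^ 2) z
      ≤ 2 * inner ℝ (X - μ r) (M.velocity u (α u x) X)
        + (8 * K * (N * K * (r - s)) + 4 * K / N) := fun u hu => by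
    have huI : u ∈ Icc s M.T := ⟨hu.1, hu.2.trans hr.2⟩
    set φ : Grid d N → ℝ := fun z =>
      2 * inner ℝ ((z : EuclideanSpace ℝ (Fin d)) - μ r) (M.velocity u (α u z) z) with hφ
    have hφb : ∀ z, |φ z| ≤ 4 * K := fun z => by
      have h1 := abs_real_inner_le_norm ((z : EuclideanSpace ℝ (Fin d)) - μ r)
        (M.velocity u (α u z) z)
      have h2 := mul_le_mul (norm_sub_le_two_of_mem_simplex z.2.1 hμr)
        (hK.velocity_le u (hsub huI) (α u z) z z.2.1) (norm_nonneg _) zero_le_two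
      rw [hφ, abs_mul, abs_two]
      linarith
    have h1 := hP.abs_sum_mul_sub_le hK hN hs huI.1 huI.2 x (h := φ)
      (c := 8 * K) (by positivity) fun z => (abs_sub _ _).trans (by linarith [hφb x, hφb z])
    have h2 : 8 * K * (N * K * (u - s)) ≤ 8 * K * (N * K * (r - s)) := by
      have := hu.2
      gcongr
    have h3 : ∑ z, P s u x z * M.generator N u (α u z) (fun w => ‖w - μ r‖ ^ 2) z
        ≤ ∑ z, P s u x z * φ z + 4 * K / N := by
      calc _ ≤ ∑ z, P s u x z * (φ z + 4 * K / N) := Finset.sum_le_sum fun z _ =>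
            mul_le_mul_of_nonneg_left
              (generator_sq_dist_le hK hN (hsub huI) (α u z) z.2.1 (μ r))
              (hP.nonneg s u hs huI.1 huI.2 x z)
        _ = _ := by
          simp only [mul_add, Finset.sum_add_distrib, ← Finset.sum_mul,
            hP.sum_eq_one s u hs huI.1 huI.2 x, one_mul]
    have h4 : φ x = 2 * inner ℝ (X - μ r) (M.velocity u (α u x) X) := rfl
    linarith [(abs_le.1 h1).2]
  have hfwd := hP.forward s r hs hr.1 hr.2 (fun w => ‖w - μ r‖ ^ 2) x
  have hIinner : IntervalIntegrable (fun u => inner ℝ (X - μ r) (M.velocity u (α u x) X))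
      volume s r :=
    ⟨(innerSL ℝ (X - μ r)).integrable_comp hIγ.1, (innerSL ℝ (X - μ r)).integrable_comp hIγ.2⟩
  have hint : ∫ u in s..r, ∑ z, P s u x z * M.generator N u (α u z) (fun w => ‖w - μ r‖ ^ 2) z
      ≤ 2 * inner ℝ (X - μ r) γ + (8 * K * (N * K * (r - s)) + 4 * K / N) * (r - s) := by
    have h1 := intervalIntegral.integral_mono_on hr.1
      (hP.intervalIntegrable_sum hs hl hr x fun z =>
        hM.generator_intervalIntegrable hK hN _ z (hα z) (hsub hl) (hsub hr))
      ((hIinner.const_mul 2).add intervalIntegrable_const) hgen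
    refine h1.trans_eq ?_
    have h2 := (innerSL ℝ (X - μ r)).intervalIntegral_comp_comm hIγ
    simp only [innerSL_apply_apply] at h2
    rw [intervalIntegral.integral_add (hIinner.const_mul 2) intervalIntegrable_const,
      intervalIntegral.integral_const_mul, intervalIntegral.integral_const, h2, smul_eq_mul]
    ring
  have hβn : ‖β‖ ≤ K * (r - s) := by
    have := hμ.norm_sub_le hM hK hs (hα x) hr
    rwa [hμβ, add_sub_cancel_left] at this
  have hγn : ‖γ‖ ≤ K * (r - s) := by
    have := intervalIntegral.norm_integral_le_of_norm_le_const (a := s) (b := r) (C := K)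
      (f := fun u => M.velocity u (α u x) X) fun u hu => by
        rw [uIoc_of_le hr.1] at hu
        exact hK.velocity_le u ⟨hs.trans hu.1.le, hu.2.trans hr.2⟩ _ _ x.2.1
    rwa [abs_of_nonneg hh] at this
  have hγβ : ‖γ - β‖ ≤ K * (‖X - y‖ + K * (r - s)) * (r - s) := by
    rw [hγ, hβ, ← intervalIntegral.integral_sub hIγ hIβ]
    have := intervalIntegral.norm_integral_le_of_norm_le_const (a := s) (b := r)
      (C := K * (‖X - y‖ + K * (r - s)))
      (f := fun u => M.velocity u (α u x) X - M.velocity u (α u x) (μ u)) fun u hu => by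
        rw [uIoc_of_le hr.1] at hu
        have huI : u ∈ Icc s M.T := ⟨hu.1.le, hu.2.trans hr.2⟩
        refine (hK.velocity_lipschitz u (hsub huI) _ X x.2.1 _ (hμ.mem_simplex u huI)).trans
          (mul_le_mul_of_nonneg_left ?_ hK0)
        have h3 := hμ.norm_sub_le hM hK hs (hα x) huI
        have h5 := norm_sub_le_norm_sub_add_norm_sub X y (μ u)
        rw [norm_sub_rev y] at h5
        have h6 := mul_le_mul_of_nonneg_left (by linarith [hu.2] : u - s ≤ r - s) hK0
        linarith
    rwa [abs_of_nonneg hh] at this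
  have hXy : ‖X - y‖ ≤ 2 := norm_sub_le_two_of_mem_simplex x.2.1 hy
  -- expand the squares around `x - y`
  have e1 : ‖X - μ r‖ ^ 2 + 2 * inner ℝ (X - μ r) γ
      = ‖X - y‖ ^ 2 + 2 * inner ℝ (X - y) (γ - β) + ‖β‖ ^ 2 - 2 * inner ℝ β γ := by
    rw [hμβ, ← sub_sub, norm_sub_sq_real (X - y) β, inner_sub_left (X - y) β γ, inner_sub_right]
    ring
  have e2 : inner ℝ (X - y) (γ - β) ≤ K * (r - s) * ‖X - y‖ ^ 2 + 2 * K ^ 2 * (r - s) ^ 2 := by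
    have h1 := real_inner_le_norm (X - y) (γ - β)
    have h2 := mul_le_mul_of_nonneg_left hγβ (norm_nonneg (X - y))
    have h3 := mul_le_mul_of_nonneg_right hXy (by positivity : 0 ≤ K ^ 2 * (r - s) ^ 2)
    linarith
  have e3 : ‖β‖ ^ 2 ≤ K ^ 2 * (r - s) ^ 2 := by
    rw [← mul_pow]
    exact pow_le_pow_left₀ (norm_nonneg _) hβn 2
  have e4 : -inner ℝ β γ ≤ K ^ 2 * (r - s) ^ 2 := by
    have h1 := (abs_le.1 (abs_real_inner_le_norm β γ)).1
    have h2 := mul_le_mul hβn hγn (norm_nonneg _) (by positivity)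
    linarith
  calc _ = ‖X - μ r‖ ^ 2 + ∫ u in s..r, ∑ z, P s u x z *
        M.generator N u (α u z) (fun w => ‖w - μ r‖ ^ 2) z := hfwd
    _ ≤ _ := by linarith

end Chain

end Model

/-! ### Comparison of the two value functions -/

theorem le_add_sq_div {ε r : ℝ} (hε : 0 < ε) : r ≤ ε + r ^ 2 / ε := by
  have h : ε + r ^ 2 / ε - r = ((r - ε / 2) ^ 2 + 3 / 4 * ε ^ 2) / ε := by
    field_simp
    ring
  have : 0 ≤ ε + r ^ 2 / ε - r := by rw [h]; positivity
  linarith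

/-- Backward induction over a uniform subdivision of `[t, T]`. The predicate `p s a θ` stands for a
bound `a + θ r²` at time `s`, where `r` is a distance. If one step of length `h` turns `a` and `θ`
into `a + K ε h + D h² + θ (B h + D h²)` and `(1 + 2 K h) θ + K h / ε`, then, as the mesh tends to
zero, the second-order terms with the factor `D` disappear. -/
theorem backward_induction {p : ℝ → ℝ → ℝ → Prop} {t T K B D ε : ℝ} (htT : t ≤ T) (hK : 0 ≤ K)
    (hB : 0 ≤ B) (hD : 0 ≤ D) (hε : 0 < ε) (hbase : p T (K * ε) (K / ε))
    (hmono : ∀ s a a' θ θ', a ≤ a' → θ ≤ θ' → p s a θ → p s a' θ')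
    (hstep : ∀ s h a θ, t ≤ s → 0 ≤ h → s + h ≤ T → 0 ≤ θ → p (s + h) a θ →
      p s (a + K * ε * h + D * h ^ 2 + θ * (B * h + D * h ^ 2))
        ((1 + 2 * K * h) * θ + K / ε * h))
    {δ : ℝ} (hp : ∀ a θ, p t a θ → δ ≤ a) :
    δ ≤ K * ε + (T - t) * (K * ε + K / ε * Real.exp ((2 * K + 1) * (T - t)) * B) := by
  have hτ : 0 ≤ T - t := sub_nonneg.2 htT
  set c := 2 * K + 1 with hc
  set Θ := K / ε * Real.exp (c * (T - t)) with hΘ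
  have hΘ0 : 0 ≤ Θ := by positivity
  have key : ∀ n : ℕ, 0 < n → δ ≤ K * ε +
      (T - t) * (K * ε + D * ((T - t) / n) + Θ * (B + D * ((T - t) / n))) := fun n hn => by
    set h := (T - t) / n with hh
    have hn0 : (0 : ℝ) < n := Nat.cast_pos.2 hn
    have h0 : 0 ≤ h := by positivity
    have hnh : n * h = T - t := by rw [hh]; field_simp
    have hind : ∀ k : ℕ, k ≤ n → p (T - k * h)
        (K * ε + k * h * (K * ε + D * h + Θ * (B + D * h)))
        (K / ε * Real.exp (c * (k * h))) := by
      intro k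
      induction k with
      | zero =>
        intro _
        simpa using hbase
      | succ k ih =>
        intro hk
        have hkn : ((k + 1 : ℕ) : ℝ) * h ≤ n * h :=
          mul_le_mul_of_nonneg_right (Nat.cast_le.2 hk) h0
        have hkh : 0 ≤ k * h := by positivity
        push_cast at hkn ⊢
        have hE : 1 ≤ Real.exp (c * (k * h)) := Real.one_le_exp (by positivity)
        have hθ : K / ε * Real.exp (c * (k * h)) ≤ Θ := by
          rw [hΘ, ← hnh]
          gcongr
          linarith
        have hprev := ih (Nat.le_of_succ_le hk)
        have e : T - k * h = (T - (k + 1) * h) + h := by ring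
        rw [e] at hprev
        refine hmono _ _ _ _ _ ?_ ?_ (hstep _ h _ _ (by linarith) h0 (by linarith)
          (by positivity) hprev)
        · have := mul_le_mul_of_nonneg_right hθ (by positivity : 0 ≤ B * h + D * h ^ 2)
          linarith
        · have h1 : Real.exp (c * ((k + 1) * h)) = Real.exp (c * (k * h)) * Real.exp (c * h) := by
            rw [← Real.exp_add]; ring_nf
          have h2 : 1 + c * h ≤ Real.exp (c * h) := by
            linarith [Real.add_one_le_exp (c * h)]
          have h3 : 0 ≤ K / ε := by positivity
          have h4 : K / ε * h ≤ K / ε * Real.exp (c * (k * h)) * h := by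
            have := mul_le_mul_of_nonneg_left hE h3
            have := mul_le_mul_of_nonneg_right this h0
            linarith
          have h5 := mul_le_mul_of_nonneg_left h2
            (by positivity : 0 ≤ K / ε * Real.exp (c * (k * h)))
          rw [h1]
          calc _ ≤ K / ε * Real.exp (c * (k * h)) * (1 + c * h) := by rw [hc] at *; linarith
            _ ≤ _ := by linarith
    have hlast := hind n le_rfl
    rw [hnh, sub_sub_cancel] at hlast
    exact hp _ _ hlast
  have hlim : Filter.Tendsto (fun n : ℕ => K * ε +
      (T - t) * (K * ε + D * ((T - t) / n) + Θ * (B + D * ((T - t) / n)))) Filter.atTop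
      (nhds (K * ε + (T - t) * (K * ε + D * 0 + Θ * (B + D * 0)))) := by
    have h := tendsto_const_div_atTop_nhds_zero_nat (T - t)
    exact ((((h.const_mul D).const_add _).add (((h.const_mul D).const_add _).const_mul _)).const_mul
      _).const_add _
  have := ge_of_tendsto hlim (Filter.eventually_atTop.2 ⟨1, fun n hn => key n hn⟩)
  simpa using this

namespace Model

variable {d : ℕ} {A : Type*} {M : Model d A} {K : ℝ} {N : ℕ}

theorem G_sub_le (hK : M.BoundedBy K) {m p : EuclideanSpace ℝ (Fin d)} (hm : m ∈ simplex d)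
    (hp : p ∈ simplex d) {ε : ℝ} (hε : 0 < ε) :
    M.G m - M.G p ≤ K * ε + K / ε * ‖p - m‖ ^ 2 := by
  have h1 := (le_abs_self _).trans (hK.G_lipschitz m hm p hp)
  have h2 := mul_le_mul_of_nonneg_left (le_add_sq_div (r := ‖m - p‖) hε) hK.nonneg
  rw [norm_sub_rev p m]
  linarith [(by ring : K * (ε + ‖m - p‖ ^ 2 / ε) = K * ε + K / ε * ‖m - p‖ ^ 2)]

theorem costN_T {α : ℝ → Grid d N → Fin d → A}
    {P : ℝ → ℝ → Matrix (Grid d N) (Grid d N) ℝ} (hP : M.IsTransitionFunction N α P)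
    (hT : 0 ≤ M.T) (x : Grid d N) : M.costN N α P M.T x = M.G x := by
  simp [costN, hP.self M.T (right_mem_Icc.2 hT), Matrix.one_apply]

/-- The bound for `|V^N - V|` at time `t` that the backward induction yields for a given parameter
`ε`, the scale at which distances are replaced by squared distances. -/
noncomputable def errorBound (M : Model d A) (K : ℝ) (N : ℕ) (ε t : ℝ) : ℝ :=
  K * ε + (M.T - t) * (K * ε + K / ε * Real.exp ((2 * K + 1) * (M.T - t)) * (4 * K / N))

/-- With `ε = 1 / √N` both contributions to the error are of order `1 / √N`. -/
theorem errorBound_le (hK : 0 ≤ K) (hN : 1 ≤ N) {t : ℝ} (ht : t ∈ Icc 0 M.T) :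
    M.errorBound K N (1 / Real.sqrt N) t
      ≤ (K + M.T * (K + 4 * K ^ 2 * Real.exp ((2 * K + 1) * M.T))) / Real.sqrt N := by
  have hN0 : (0 : ℝ) < N := Nat.cast_pos.2 hN
  have hT : 0 ≤ M.T := ht.1.trans ht.2
  have hle : M.T - t ≤ M.T := by linarith [ht.1]
  have hsq : Real.sqrt N * Real.sqrt N = N := Real.mul_self_sqrt hN0.le
  have h0 : (N : ℝ)⁻¹ * Real.sqrt N = (Real.sqrt N)⁻¹ := by
    nth_rewrite 1 [← hsq]
    field_simp
  have e : ∀ τ, K * (1 / Real.sqrt N) + τ * (K * (1 / Real.sqrt N)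
      + K / (1 / Real.sqrt N) * Real.exp ((2 * K + 1) * τ) * (4 * K / N))
      = (K + τ * (K + 4 * K ^ 2 * Real.exp ((2 * K + 1) * τ))) / Real.sqrt N := fun τ => by
    have : K / (1 / Real.sqrt N) * Real.exp ((2 * K + 1) * τ) * (4 * K / N)
        = 4 * K ^ 2 * Real.exp ((2 * K + 1) * τ) * ((N : ℝ)⁻¹ * Real.sqrt N) := by
      rw [div_div_eq_mul_div]
      ring
    rw [this, h0]
    ring
  rw [errorBound, e]
  gcongr

variable [MetricSpace A] [CompactSpace A] [MeasurableSpace A] [BorelSpace A]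

/-- One step of the backward induction: a quadratic bound at time `r` for the difference
of two costs passes to time `s`. The number `w` stands for a mean field cost or value
at `r = s + h`, and the sign `σ = ± 1` selects which of the two problems is bounded by the other. -/
theorem IsTransitionFunction.step_le {α : ℝ → Grid d N → Fin d → A}
    {P : ℝ → ℝ → Matrix (Grid d N) (Grid d N) ℝ} (hP : M.IsTransitionFunction N α P)
    (hM : M.Regular) (hK : M.BoundedBy K) (hN : 1 ≤ N) (hα : ∀ y, Measurable fun s => α s y)
    {s h : ℝ} (hs : 0 ≤ s) (hh : 0 ≤ h) (hr : s + h ≤ M.T) (x : Grid d N)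
    {y : EuclideanSpace ℝ (Fin d)} {μ : ℝ → EuclideanSpace ℝ (Fin d)}
    (hμ : M.IsTrajectory (fun u => α u x) s y μ) {σ : ℝ} (hσ : |σ| = 1) {w : ℝ} {ε a θ : ℝ}
    (hε : 0 < ε) (hθ : 0 ≤ θ)
    (hend : ∀ z : Grid d N, σ * (w - M.costN N α P (s + h) z) ≤ a + θ * ‖z - μ (s + h)‖ ^ 2) :
    σ * ((∫ u in s..s + h, M.F u (α u x) (μ u)) + w - M.costN N α P s x)
      ≤ (a + K * ε * h + (8 * N + 7) * K ^ 2 * h ^ 2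
          + θ * (4 * K / N * h + (8 * N + 7) * K ^ 2 * h ^ 2))
        + ((1 + 2 * K * h) * θ + K / ε * h) * ‖x - y‖ ^ 2 := by
  have hrI : s + h ∈ Icc s M.T := ⟨by linarith, hr⟩
  have hsum := hP.sum_eq_one s (s + h) hs hrI.1 hr x
  have h1 := hP.abs_integral_F_sub_le hM hK hN hα hs hrI x hμ
  have h2 := mul_le_mul_of_nonneg_left (hP.sum_sq_dist_le hM hK hN hα hs hrI x hμ) hθ
  rw [add_sub_cancel_left] at h1 h2
  have h3 : ∑ z, P s (s + h) x z * (σ * (w - M.costN N α P (s + h) z))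
      ≤ a + θ * ∑ z, P s (s + h) x z * ‖z - μ (s + h)‖ ^ 2 := by
    calc _ ≤ ∑ z, P s (s + h) x z * (a + θ * ‖z - μ (s + h)‖ ^ 2) := Finset.sum_le_sum fun z _ =>
          mul_le_mul_of_nonneg_left (hend z) (hP.nonneg s (s + h) hs hrI.1 hr x z)
      _ = _ := by
        simp only [mul_add, Finset.sum_add_distrib, ← Finset.sum_mul, hsum, one_mul,
          Finset.mul_sum]
        congr 1
        exact Finset.sum_congr rfl fun z _ => by ring
  have h4 : ∑ z, P s (s + h) x z * (σ * (w - M.costN N α P (s + h) z))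
      = σ * (w - ∑ z, P s (s + h) x z * M.costN N α P (s + h) z) := by
    have : ∀ z, P s (s + h) x z * (σ * (w - M.costN N α P (s + h) z))
        = σ * w * P s (s + h) x z - σ * (P s (s + h) x z * M.costN N α P (s + h) z) :=
      fun z => by ring
    simp only [this, Finset.sum_sub_distrib, ← Finset.mul_sum, hsum]
    ring
  set I := ∫ u in s..s + h, ∑ z, P s u x z * M.F u (α u z) z
  set J := ∫ u in s..s + h, M.F u (α u x) (μ u)
  have h5 : σ * (J - I) ≤ |I - J| := by
    rw [abs_sub_comm]
    calc _ ≤ |σ * (J - I)| := le_abs_self _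
      _ = _ := by rw [abs_mul, hσ, one_mul]
  have h6 := mul_le_mul_of_nonneg_left (le_add_sq_div (r := ‖x - y‖) hε)
    (mul_nonneg hK.nonneg hh)
  have h7 : K * h * (ε + ‖x - y‖ ^ 2 / ε) = K * ε * h + K / ε * h * ‖x - y‖ ^ 2 := by ring
  rw [hP.costN_eq hM hK hα hs hrI x]
  rw [h4] at h3
  linarith

theorem value_T_le [Nonempty A] (hM : M.Regular) (hK : M.BoundedBy K) (hT : 0 ≤ M.T)
    {m : EuclideanSpace ℝ (Fin d)} (hm : m ∈ simplex d) : M.value M.T m ≤ M.G m := by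
  have hα : Measurable (fun (_ : ℝ) (_ : Fin d) => Classical.arbitrary A) := measurable_const
  obtain ⟨μ, hμ⟩ := exists_isTrajectory hM hK (right_mem_Icc.2 hT) hα hm
  refine (value_le_cost hK (right_mem_Icc.2 hT) hα hμ).trans_eq ?_
  simp [cost, hμ.left_eq le_rfl]

/-- No feedback control of the chain does essentially better than the best deterministic control:
along each step the trajectory uses the action prescribed at the current point of the chain. -/
theorem value_sub_costN_le [Nonempty A] (hM : M.Regular) (hK : M.BoundedBy K) (hN : 1 ≤ N)
    {α : ℝ → Grid d N → Fin d → A} {P : ℝ → ℝ → Matrix (Grid d N) (Grid d N) ℝ}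
    (hP : M.IsTransitionFunction N α P) (hα : ∀ y, Measurable fun s => α s y) {t : ℝ}
    (ht : t ∈ Icc 0 M.T) (x : Grid d N) {ε : ℝ} (hε : 0 < ε) :
    M.value t x - M.costN N α P t x ≤ M.errorBound K N ε t := by
  have hK0 := hK.nonneg
  have hT : 0 ≤ M.T := ht.1.trans ht.2
  refine backward_induction (p := fun s a θ => ∀ (x : Grid d N), ∀ y ∈ simplex d,
    M.value s y - M.costN N α P s x ≤ a + θ * ‖x - y‖ ^ 2) (D := (8 * N + 7) * K ^ 2)
    ht.2 hK0 (by positivity) (by positivity) hε ?_ ?_ ?_ ?_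
  · intro x y hy
    rw [costN_T hP hT]
    linarith [value_T_le hM hK hT hy, G_sub_le hK hy x.2.1 hε]
  · intro s a a' θ θ' ha hθ h x y hy
    have := mul_le_mul_of_nonneg_right hθ (sq_nonneg ‖x - y‖)
    linarith [h x y hy]
  · intro s h a θ hts hh hr hθ hprev x y hy
    have hs : 0 ≤ s := ht.1.trans hts
    have hrI : s + h ∈ Icc s M.T := ⟨by linarith, hr⟩
    obtain ⟨μ, hμ⟩ := exists_isTrajectory hM hK ⟨hs, by linarith⟩ (hα x) hy
    have h1 := hP.step_le hM hK hN hα hs hh hr x hμ (σ := 1) (w := M.value (s + h) (μ (s + h)))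
      abs_one hε hθ fun z => by
        rw [one_mul]
        exact hprev z _ (hμ.mem_simplex _ hrI)
    have h2 := value_le_integral_add_value hM hK hs (hα x) hμ hrI
    rw [one_mul] at h1
    linarith
  · intro a θ h
    simpa using h x x x.2.1

/-- A deterministic control, used by all agents, costs the chain about as much as it costs in the
mean field problem. -/
theorem costN_sub_cost_le (hM : M.Regular) (hK : M.BoundedBy K) (hN : 1 ≤ N)
    {α : ℝ → Fin d → A} (hα : Measurable α) {P : ℝ → ℝ → Matrix (Grid d N) (Grid d N) ℝ}
    (hP : M.IsTransitionFunction N (fun s _ => α s) P) {t : ℝ}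
    (ht : t ∈ Icc 0 M.T) (x : Grid d N) {μ : ℝ → EuclideanSpace ℝ (Fin d)}
    (hμ : M.IsTrajectory α t x μ) {ε : ℝ} (hε : 0 < ε) :
    M.costN N (fun s _ => α s) P t x - M.cost α μ t ≤ M.errorBound K N ε t := by
  have hK0 := hK.nonneg
  have hT : 0 ≤ M.T := ht.1.trans ht.2
  refine backward_induction (p := fun s a θ => ∀ (x : Grid d N),
    M.costN N (fun s _ => α s) P s x - M.cost α μ s ≤ a + θ * ‖x - μ s‖ ^ 2)
    (D := (8 * N + 7) * K ^ 2)
    ht.2 hK0 (by positivity) (by positivity) hε ?_ ?_ ?_ ?_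
  · intro x
    have h1 := G_sub_le hK x.2.1 (hμ.mem_simplex _ (right_mem_Icc.2 ht.2)) hε
    rw [costN_T hP hT, norm_sub_rev]
    simpa [cost] using h1
  · intro s a a' θ θ' ha hθ h x
    have := mul_le_mul_of_nonneg_right hθ (sq_nonneg ‖x - μ s‖)
    linarith [h x]
  · intro s h a θ hts hh hr hθ hprev x
    have hs : 0 ≤ s := ht.1.trans hts
    have hrI : s + h ∈ Icc s M.T := ⟨by linarith, hr⟩
    have hsI : s ∈ Icc t M.T := ⟨hts, hrI.1.trans hr⟩
    have hμs := hμ.restrict hM hK ht.1 hα hsI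
    have h1 := hP.step_le hM hK hN (fun _ => hα) hs hh hr x hμs (σ := -1)
      (w := M.cost α μ (s + h)) (a := a) (by simp) hε hθ fun z => by linarith [hprev z]
    rw [hμs.cost_eq hM hK hs hα hrI]
    linarith
  · intro a θ h
    simpa [hμ.left_eq ht.2] using h x

theorem abs_valueN_sub_value_le [Nonempty A] (hM : M.Regular) (hK : M.BoundedBy K) (hN : 1 ≤ N)
    {t : ℝ}
    (ht : t ∈ Icc 0 M.T) (x : Grid d N) {ε : ℝ} (hε : 0 < ε) :
    |M.valueN N t x - M.value t x| ≤ M.errorBound K N ε t := by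
  rw [abs_sub_le_iff]
  constructor
  · rw [sub_le_comm]
    refine le_value hM hK ht x.2.1 fun α μ hα hμ => ?_
    obtain ⟨P, hP⟩ := exists_isTransitionFunction (N := N) (α := fun s _ => α s) hM hK hN
      fun _ => hα
    linarith [costN_sub_cost_le hM hK hN hα hP ht x hμ hε, valueN_le_costN hK ht (fun _ => hα) hP x]
  · rw [sub_le_comm]
    refine le_valueN hM hK hN fun α P hα hP => ?_
    linarith [value_sub_costN_le hM hK hN hP hα ht x hε]

theorem continuousOn_abs_valueN_sub_value [Nonempty A] (hM : M.Regular) (hK : M.BoundedBy K)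
    (hN : 1 ≤ N)
    (x : Grid d N) : ContinuousOn (fun t => |M.valueN N t x - M.value t x|) (Icc 0 M.T) := by
  have key : ∀ (φ : ℝ → ℝ) (L : ℝ),
      (∀ t s, 0 ≤ t → t ≤ s → s ≤ M.T → |φ t - φ s| ≤ L * (s - t)) →
      ContinuousOn φ (Icc 0 M.T) := fun φ L h => by
    refine (LipschitzOnWith.of_dist_le' (K := L) fun t ht s hs => ?_).continuousOn
    rw [Real.dist_eq, Real.dist_eq]
    rcases le_total t s with hts | hts
    · rw [abs_sub_comm t s, abs_of_nonneg (sub_nonneg.2 hts)]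
      exact h t s ht.1 hts hs.2
    · rw [abs_sub_comm, abs_of_nonneg (sub_nonneg.2 hts)]
      exact h s t hs.1 hts ht.2
  exact ((key _ _ fun t s h1 h2 h3 => abs_valueN_sub_valueN_le hM hK hN h1 h2 h3 x).sub
    (key _ _ fun t s h1 h2 h3 => abs_value_sub_value_le hM hK h1 h2 h3 x.2.1)).abs

end Model

end MFC

theorem theorem2p6 {d : ℕ} (hd : 0 < d) {A : Type*} [MetricSpace A] [CompactSpace A] [Nonempty A]
    [MeasurableSpace A] [BorelSpace A] (M : MFC.Model d A) (hT : 0 ≤ M.T) (hM : M.Regular) :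
    ∃ C : ℝ, ∀ N : ℕ, 1 ≤ N → ∃ e : ℝ,
      IsGreatest {y : ℝ | ∃ t ∈ Set.Icc 0 M.T, ∃ m : MFC.Grid d N,
        y = |M.valueN N t m - M.value t m|} e ∧
      e ≤ C / Real.sqrt N := by
  obtain ⟨K, hK⟩ := hM.exists_boundedBy
  refine ⟨K + M.T * (K + 4 * K ^ 2 * Real.exp ((2 * K + 1) * M.T)), fun N hN => ?_⟩
  have := MFC.grid_nonempty hd hN
  have hset : {y : ℝ | ∃ t ∈ Set.Icc 0 M.T, ∃ m : MFC.Grid d N,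
      y = |M.valueN N t m - M.value t m|}
      = ⋃ m : MFC.Grid d N, (fun t => |M.valueN N t m - M.value t m|) '' Set.Icc 0 M.T := by
    ext y
    simp only [Set.mem_iUnion, Set.mem_image]
    constructor
    · rintro ⟨t, ht, m, rfl⟩
      exact ⟨m, t, ht, rfl⟩
    · rintro ⟨m, t, ht, rfl⟩
      exact ⟨t, ht, m, rfl⟩
  have hcp : IsCompact {y : ℝ | ∃ t ∈ Set.Icc 0 M.T, ∃ m : MFC.Grid d N,
      y = |M.valueN N t m - M.value t m|} := by
    rw [hset]
    exact isCompact_iUnion fun m => isCompact_Icc.image_of_continuousOn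
      (MFC.Model.continuousOn_abs_valueN_sub_value hM hK hN m)
  obtain ⟨e, he⟩ := hcp.exists_isGreatest
    ⟨_, 0, Set.left_mem_Icc.2 hT, Classical.arbitrary (MFC.Grid d N), rfl⟩
  refine ⟨e, he, ?_⟩
  obtain ⟨t, ht, m, rfl⟩ := he.1
  have hN0 : (0 : ℝ) < N := Nat.cast_pos.2 hN
  exact (MFC.Model.abs_valueN_sub_value_le hM hK hN ht m
    (one_div_pos.2 (Real.sqrt_pos.2 hN0))).trans (MFC.Model.errorBound_le hK.nonneg hN ht)
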